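/- Let $m,n\ge 0$ be integers and let $M=[0,1]\times\mathbb T^n$, $\mathbb T^n=\mathbb R^n/\mathbb Z^n$, with coordinates $(x,y)$. For an integer $d$ let $P_d$ be the space of complex homogeneous polynomials of degree $d$ in $(v,w)\in\mathbb R\times\mathbb R^n$, with the norm of $L^2(S^n)$ ($S^n\subset\mathbb R^{n+1}$ the unit sphere) and with $P_{-1}=0$; a symmetric tensor field of order $d$ on $M$ is a function $M\to P_d$, written $f(x,y;v,w)$. For $f\in L^2(M;P_m)$ the X-ray transform over boundary-to-boundary geodesics is $$I^mf(a,b)=\int_0^1 f(t,a+bt;1,b)\,dt,$$ defined for every $b\in\mathbb R^n$ and almost every $a\in\mathbb T^n$; $I^mf=0$ means that it vanishes for all such $(a,b)$. For $g\in H^1(M;P_{m-1})$ the symmetrized derivative is $dg(x,y;v,w)=(v\,\partial_x+w\cdot\nabla_y)g(x,y;v,w)$, in the weak sense. $H^1_0(M;P_{m-1})$ is the space of $g\in H^1(M;P_{m-1})$ with zero trace on $\partial M=\{0,1\}\times\mathbb T^n$, with the norm $\|g\|_{H^1_0}^2=\|g\|_{L^2}^2+\|\partial_xg\|_{L^2}^2+\sum_{j=1}^n\|\partial_{y_j}g\|_{L^2}^2$.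 Let $\pi\colon M\to[0,1]$ be the projection. **Theorem.** There is a constant $C=C(n,m)$ such that for every $f\in L^2(M;P_m)$ the following are equivalent: 1. $I^mf=0$. 2. There are $h\in L^2([0,1];P_m)$ and $g\in H^1_0(M;P_{m-1})$ such that $\int_0^1h(x;v,w)\,dx=0$ for all $(v,w)\in\mathbb R^{n+1}$ and $f=\pi^*h+dg$ almost everywhere. 3. There are $h$ and $g$ as in 2 which satisfy in addition $$\|h\|_{L^2([0,1];P_m)}+\|g\|_{H^1_0(M;P_{m-1})}\le C\,\|f\|_{L^2(M;P_m)}.$$ -/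

import Mathlib

open MeasureTheory Filter Topology
open scoped ContDiff

noncomputable section

namespace PeriodicSlab

/-! ### The slab and tensor fields on it -/

/-- The periodic slab `M = [0,1] × 𝕋ⁿ`, with its product Lebesgue measure `volume`. -/
abbrev Slab (n : ℕ) : Type := unitInterval × UnitAddTorus (Fin n)

/-- The cylinder `ℝ × 𝕋ⁿ` containing the slab; smooth functions on the slab are the restrictions
of smooth functions on the cylinder. -/
abbrev Cylinder (n : ℕ) : Type := ℝ × UnitAddTorus (Fin n)

/-- The inclusion of the slab into the cylinder. -/
def toCylinder {n : ℕ} (z : Slab n) : Cylinder n := ((z.1 : ℝ), z.2)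

/-- Complex homogeneous polynomials of degree `d` on `ℝⁿ⁺¹`, the zero space if `d < 0`.
The variable `0` is `v` and the variables `1, …, n` are `w₁, …, wₙ`. -/
def Pol (n : ℕ) : ℤ → Submodule ℂ (MvPolynomial (Fin (n + 1)) ℂ)
  | Int.ofNat d => MvPolynomial.homogeneousSubmodule (Fin (n + 1)) ℂ d
  | Int.negSucc _ => ⊥

/-- The value of a complex polynomial at a real vector. -/
def evalAt {n : ℕ} (p : MvPolynomial (Fin (n + 1)) ℂ) (u : Fin (n + 1) → ℝ) : ℂ :=
  MvPolynomial.eval (fun i => (u i : ℂ)) p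

/-- A symmetric tensor field of order `d` on the slab, seen as a field of homogeneous polynomials
of degree `d` (identically zero if `d < 0`). -/
abbrev TensorField (n : ℕ) (d : ℤ) : Type := Slab n → Pol n d

/-- The coefficient functions of a field of polynomials. -/
def coeffFn {n : ℕ} {d : ℤ} {X : Type*} (F : X → Pol n d) (α : Fin (n + 1) →₀ ℕ) : X → ℂ :=
  fun z => MvPolynomial.coeff α (F z : MvPolynomial (Fin (n + 1)) ℂ)

/-! ### `L²` spaces -/

/-- A field of polynomials is in `L²` if all its coefficients are. -/
def MemL2 {n : ℕ} {d : ℤ} {X : Type*} [MeasureSpace X] (F : X → Pol n d) : Prop :=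
  ∀ α : Fin (n + 1) →₀ ℕ, MemLp (coeffFn F α) 2 volume

/-- The square of the norm of a polynomial in `L²(Sⁿ)`, for the surface measure of the unit
sphere `Sⁿ ⊆ ℝⁿ⁺¹`. -/
def polNormSq {n : ℕ} (p : MvPolynomial (Fin (n + 1)) ℂ) : ℝ :=
  ∫ u : Metric.sphere (0 : EuclideanSpace ℝ (Fin (n + 1))) 1,
    ‖evalAt p (fun i => (u : EuclideanSpace ℝ (Fin (n + 1))) i)‖ ^ 2
    ∂((volume : Measure (EuclideanSpace ℝ (Fin (n + 1)))).toSphere)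

/-- The square of the `L²` norm of a field of polynomials, the polynomials being normed by
`L²(Sⁿ)`. -/
def l2NormSq {n : ℕ} {d : ℤ} {X : Type*} [MeasureSpace X] (F : X → Pol n d) : ℝ :=
  ∫ z, polNormSq (F z : MvPolynomial (Fin (n + 1)) ℂ)

/-- The `L²` norm of a field of polynomials. -/
def l2Norm {n : ℕ} {d : ℤ} {X : Type*} [MeasureSpace X] (F : X → Pol n d) : ℝ :=
  Real.sqrt (l2NormSq F)

/-! ### The X-ray transform -/

/-- The integral of `f` over the geodesic `t ↦ (t, a + b t)`, `t ∈ [0,1]`, whose velocity is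
`(1, b)`. -/
def xray {n : ℕ} {d : ℤ} (f : TensorField n d) (a : UnitAddTorus (Fin n)) (b : Fin n → ℝ) : ℂ :=
  ∫ t : unitInterval,
    evalAt (f (t, fun j => a j + (((t : ℝ) * b j : ℝ) : UnitAddCircle)) :
      MvPolynomial (Fin (n + 1)) ℂ) (Fin.cons 1 b)

/-- The X-ray transform of `f` vanishes. For `L²` fields `xray f a b` is defined, and independent
of the representative of `f`, for every `b` and almost every `a`. -/
def XRayVanishes {n : ℕ} {d : ℤ} (f : TensorField n d) : Prop :=
  ∀ b : Fin n → ℝ, ∀ᵐ a : UnitAddTorus (Fin n), xray f a b = 0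

/-! ### Smooth functions and Sobolev spaces -/

/-- A function on `ℝ × 𝕋ⁿ` is smooth if its lift to `ℝⁿ⁺¹` is. -/
def IsSmooth {n : ℕ} (φ : Cylinder n → ℂ) : Prop :=
  ContDiff ℝ ∞ (fun z : Fin (n + 1) → ℝ => φ (z 0, fun j => (z j.succ : UnitAddCircle)))

/-- The displacement by `t` along the coordinate `i`; the coordinate `0` is `x` and the coordinates
`1, …, n` are `y₁, …, yₙ`. -/
def displacement {n : ℕ} (i : Fin (n + 1)) (t : ℝ) : Cylinder n :=
  Fin.cases (motive := fun _ => Cylinder n) (t, 0)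
    (fun j => (0, Pi.single j (t : UnitAddCircle))) i

/-- The classical partial derivative along the coordinate `i`. -/
def partialD {n : ℕ} (i : Fin (n + 1)) (φ : Cylinder n → ℂ) (p : Cylinder n) : ℂ :=
  deriv (fun t : ℝ => φ (p + displacement i t)) 0

/-- Test functions: smooth functions whose (then automatically compact) support lies in the
interior `(0,1) × 𝕋ⁿ` of the slab. -/
def IsTestFunction {n : ℕ} (φ : Cylinder n → ℂ) : Prop :=
  IsSmooth φ ∧ tsupport φ ⊆ Set.Ioo (0 : ℝ) 1 ×ˢ Set.univ

/-- `u' ∈ L²` is the weak partial derivative of `u` along the coordinate `i` in the interior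
of the slab. -/
def IsWeakPartial {n : ℕ} (i : Fin (n + 1)) (u u' : Slab n → ℂ) : Prop :=
  MemLp u' 2 volume ∧ ∀ φ : Cylinder n → ℂ, IsTestFunction φ →
    ∫ z, u z * partialD i φ (toCylinder z) = -∫ z, u' z * φ (toCylinder z)

/-- `u` has boundary trace `τ₀` on `{0} × 𝕋ⁿ` and `τ₁` on `{1} × 𝕋ⁿ`: it is a limit in the usual
`H¹(M)` of functions smooth up to the boundary, whose boundary values converge to `τ₀` and `τ₁`
in `L²`. In other words, the trace is the extension by continuity of the restriction to the
boundary. -/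
def HasTrace {n : ℕ} (u : Slab n → ℂ) (τ₀ τ₁ : UnitAddTorus (Fin n) → ℂ) : Prop :=
  ∃ U : Fin (n + 1) → Slab n → ℂ, (∀ i, IsWeakPartial i u (U i)) ∧
  ∃ φ : ℕ → Cylinder n → ℂ, (∀ k, IsSmooth (φ k)) ∧
    Tendsto (fun k => eLpNorm (fun z => φ k (toCylinder z) - u z) 2 volume) atTop (𝓝 0) ∧
    (∀ i, Tendsto (fun k => eLpNorm (fun z => partialD i (φ k) (toCylinder z) - U i z) 2 volume)
      atTop (𝓝 0)) ∧
    Tendsto (fun k => eLpNorm (fun y => φ k (0, y) - τ₀ y) 2 volume) atTop (𝓝 0) ∧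
    Tendsto (fun k => eLpNorm (fun y => φ k (1, y) - τ₁ y) 2 volume) atTop (𝓝 0)

/-- `G` is the weak gradient of the tensor field `g`, with coefficients in `L²`. -/
def IsWeakGradient {n : ℕ} {d : ℤ} (g : TensorField n d)
    (G : Fin (n + 1) → TensorField n d) : Prop :=
  ∀ i (α : Fin (n + 1) →₀ ℕ), IsWeakPartial i (coeffFn g α) (coeffFn (G i) α)

/-- The space `H¹(M)` of tensor fields. -/
def MemH1 {n : ℕ} {d : ℤ} (g : TensorField n d) : Prop :=
  MemL2 g ∧ ∃ G, IsWeakGradient g G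

/-- The space `H¹₀(M)` of tensor fields: those in `H¹(M)` with zero boundary trace. -/
def MemH10 {n : ℕ} {d : ℤ} (g : TensorField n d) : Prop :=
  MemH1 g ∧ ∀ α : Fin (n + 1) →₀ ℕ, HasTrace (coeffFn g α) 0 0

open Classical in
/-- The weak gradient of a field in `H¹(M)` (unique up to null sets; zero by convention for other
fields). -/
def weakGrad {n : ℕ} {d : ℤ} (g : TensorField n d) : Fin (n + 1) → TensorField n d :=
  if h : ∃ G, IsWeakGradient g G then h.choose else 0

/-- The `H¹` norm, `‖g‖² = ‖g‖²_{L²} + ∑ᵢ ‖∂ᵢ g‖²_{L²}`. -/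
def h1Norm {n : ℕ} {d : ℤ} (g : TensorField n d) : ℝ :=
  Real.sqrt (l2NormSq g + ∑ i, l2NormSq (weakGrad g i))

/-- The symmetrized covariant derivative `dg(x, y; v, w) = (v ∂ₓ + w · ∇_y) g(x, y; v, w)`,
in the weak sense. -/
def symDeriv {n : ℕ} {d : ℤ} (g : TensorField n d) (z : Slab n) :
    MvPolynomial (Fin (n + 1)) ℂ :=
  ∑ i, MvPolynomial.X i * (weakGrad g i z : MvPolynomial (Fin (n + 1)) ℂ)

/-- `f = π^*h + dg` with `h ∈ L²([0,1])` of zero mean and `g ∈ H¹₀(M)` of order one less. -/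
structure IsDecomposition {n m : ℕ} (f : TensorField n m) (h : unitInterval → Pol n m)
    (g : TensorField n ((m : ℤ) - 1)) : Prop where
  memL2 : MemL2 h
  mean_zero : ∀ u : Fin (n + 1) → ℝ,
    ∫ x : unitInterval, evalAt (h x : MvPolynomial (Fin (n + 1)) ℂ) u = 0
  memH10 : MemH10 g
  eq : ∀ᵐ z : Slab n, (f z : MvPolynomial (Fin (n + 1)) ℂ) = h z.1 + symDeriv g z

end PeriodicSlab

end

/-!
The X-ray transform commutes with translations along `𝕋ⁿ`, and the operator `d` is diagonalized by
Fourier series in all `n + 1` variables, the slab being identified, up to a null set, with the torus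
`𝕋ⁿ⁺¹`. Write
`E_ξ(x, y) = exp (2πi ξ · (x, y))` for `ξ = (l, k) ∈ ℤ × ℤⁿ` and `f̂(ξ)` for the Fourier
coefficients of `f`, which are homogeneous polynomials of degree `m` in `(v, w)`.

Straightening the geodesics of direction `b` by a shear shows that the X-ray transform of `f`
vanishes if and only if, for all `b ∈ ℝⁿ` and `k ∈ ℤⁿ`,
`∫_M f(x, y; 1, b) exp (2πi (x k · b - k · y)) = 0` (`xrayVanishes_iff`). The wave under the
integral is constant along the geodesics of direction `b`, so these integrals vanish for `dg` with
`g ∈ H¹₀(M)` by integration by parts; for `π^*h` they vanish by orthogonality and because `h` has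
mean zero (`IsDecomposition.xrayVanishes`). The boundary terms disappear because `g` is a limit in
`H¹` of smooth functions whose boundary values tend to zero.

Conversely, suppose that all these integrals vanish.

* If `k · b = -l` is an integer, the integral is `f̂(l, k)(1, b)`. Hence `f̂(ξ)` vanishes on the
  hyperplane orthogonal to `ξ`, and if `k ≠ 0` it is divisible by the linear form `ξ`:
  `f̂(ξ) = 2πi (ξ · (v, w)) Q(ξ)` (`exists_potentialCoef`). Multiplication by linear forms of norm
  one is bounded below on homogeneous polynomials, by compactness (`exists_division_bound`), whence
  `|ξ| ‖Q(ξ)‖ ≤ C ‖f̂(ξ)‖`. So `g = ∑_{k ≠ 0} Q(ξ) E_ξ` lies in `H¹` of the torus, with the required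
  bound, and `dg` is the part of `f` with frequencies `k ≠ 0`.
* If `θ = k · b` is not an integer, Parseval's identity turns the integral into
  `(exp (2πiθ) - 1) ∑_l Q(l, k)(1, b)`. As these `b` are dense, `∑_l Q(l, k) = 0`
  (`tsum_potentialCoef`), which says that the boundary values of `g` are zero. In the definition of
  the trace one can therefore use the partial sums of the Fourier series over boxes
  (`hasTrace_zero`).
* The part of `f` with `k = 0` is `π^*h` with `h(x) = ∫ f(x, y) dy`, and `f̂(0) = 0` says that `h`
  has mean zero.

The weak gradient that enters `dg` and the `H¹` norm is only chosen, but weak derivatives are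
unique up to null sets (`IsWeakPartial.ae_eq`).
-/

noncomputable section

namespace PeriodicSlab

open scoped ComplexConjugate

/-! ### Homogeneous polynomials -/

/-- The exponents of the monomials of degree `d` in `n + 1` variables; none if `d < 0`. -/
def exps (n : ℕ) (d : ℤ) : Finset (Fin (n + 1) →₀ ℕ) :=
  (Finset.finsuppAntidiag Finset.univ d.toNat).filter fun α => (α.degree : ℤ) = d

lemma mem_exps {n : ℕ} {d : ℤ} {α : Fin (n + 1) →₀ ℕ} :
    α ∈ exps n d ↔ (α.degree : ℤ) = d := by
  rw [exps, Finset.mem_filter, Finset.mem_finsuppAntidiag]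
  refine ⟨fun h => h.2, fun h => ⟨⟨?_, Finset.subset_univ _⟩, h⟩⟩
  rw [← h, Finsupp.degree_eq_sum, Int.toNat_natCast]

lemma mem_pol_iff {n : ℕ} {d : ℤ} {p : MvPolynomial (Fin (n + 1)) ℂ} :
    p ∈ Pol n d ↔ ∀ α, p.coeff α ≠ 0 → (α.degree : ℤ) = d := by
  cases d with
  | ofNat d =>
    change p ∈ MvPolynomial.homogeneousSubmodule (Fin (n + 1)) ℂ d ↔ _
    rw [MvPolynomial.mem_homogeneousSubmodule]
    constructor
    · intro h α hα
      by_contra hne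
      exact hα (h.coeff_eq_zero fun he => hne (by rw [he]; rfl))
    · intro h α hα
      have := h α hα
      have h2 := DFunLike.congr_fun (Finsupp.degree_eq_weight_one (R := ℕ) (σ := Fin (n + 1))) α
      exact h2.symm.trans (Int.ofNat_inj.mp this)
  | negSucc d =>
    change p ∈ (⊥ : Submodule ℂ (MvPolynomial (Fin (n + 1)) ℂ)) ↔ _
    rw [Submodule.mem_bot]
    constructor
    · rintro rfl α hα
      simp at hα
    · intro h
      ext α
      by_contra hne
      have := h α (by simpa using hne)
      have h2 := Int.negSucc_lt_zero d
      omega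

lemma coeff_eq_zero_of_notMem_exps {n : ℕ} {d : ℤ} {p : MvPolynomial (Fin (n + 1)) ℂ}
    (hp : p ∈ Pol n d) {α : Fin (n + 1) →₀ ℕ} (hα : α ∉ exps n d) : p.coeff α = 0 := by
  by_contra h
  exact hα (mem_exps.2 (mem_pol_iff.1 hp α h))

/-- The polynomial of degree `d` with prescribed coefficients. -/
def ofCoeffs (n : ℕ) (d : ℤ) (c : (Fin (n + 1) →₀ ℕ) → ℂ) : Pol n d :=
  ⟨∑ α ∈ exps n d, MvPolynomial.monomial α (c α), by
    rw [mem_pol_iff]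
    intro β hβ
    by_contra hne
    apply hβ
    rw [MvPolynomial.coeff_sum]
    refine Finset.sum_eq_zero fun α hα => ?_
    rw [MvPolynomial.coeff_monomial, if_neg]
    rintro rfl
    exact hne (mem_exps.1 hα)⟩

lemma coeff_ofCoeffs {n : ℕ} {d : ℤ} (c : (Fin (n + 1) →₀ ℕ) → ℂ) (β : Fin (n + 1) →₀ ℕ) :
    (ofCoeffs n d c : MvPolynomial (Fin (n + 1)) ℂ).coeff β = if β ∈ exps n d then c β else 0 := by
  classical
  simp only [ofCoeffs, MvPolynomial.coeff_sum, MvPolynomial.coeff_monomial]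
  simp

lemma evalAt_eq_sum {n : ℕ} {d : ℤ} {p : MvPolynomial (Fin (n + 1)) ℂ} (hp : p ∈ Pol n d)
    (u : Fin (n + 1) → ℝ) :
    evalAt p u = ∑ α ∈ exps n d, p.coeff α * ∏ i, (u i : ℂ) ^ α i := by
  rw [evalAt, MvPolynomial.eval_eq']
  refine Finset.sum_subset ?_ ?_
  · intro α hα
    exact mem_exps.2 (mem_pol_iff.1 hp α (MvPolynomial.mem_support_iff.1 hα))
  · intro α _ hα
    rw [MvPolynomial.notMem_support_iff.1 hα, zero_mul]

lemma evalAt_smul {n : ℕ} {d : ℤ} {p : MvPolynomial (Fin (n + 1)) ℂ} (hp : p ∈ Pol n d)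
    (s : ℝ) (u : Fin (n + 1) → ℝ) : evalAt p (s • u) = (s : ℂ) ^ d.toNat * evalAt p u := by
  rw [evalAt_eq_sum hp, evalAt_eq_sum hp, Finset.mul_sum]
  refine Finset.sum_congr rfl fun α hα => ?_
  have h : d.toNat = ∑ i, α i := by
    rw [← mem_exps.1 hα, Finsupp.degree_eq_sum, Int.toNat_natCast]
  simp only [Pi.smul_apply, smul_eq_mul, Complex.ofReal_mul, mul_pow, Finset.prod_mul_distrib]
  rw [Finset.prod_pow_eq_pow_sum, h]
  ring

lemma continuous_evalAt {n : ℕ} (p : MvPolynomial (Fin (n + 1)) ℂ) : Continuous (evalAt p) := by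
  unfold evalAt
  exact (MvPolynomial.continuous_eval p).comp (by fun_prop)

lemma evalAt_mul {n : ℕ} (p q : MvPolynomial (Fin (n + 1)) ℂ) (u : Fin (n + 1) → ℝ) :
    evalAt (p * q) u = evalAt p u * evalAt q u := by simp [evalAt]

lemma eq_zero_of_evalAt_eq_zero {n : ℕ} {p : MvPolynomial (Fin (n + 1)) ℂ}
    (h : ∀ u, evalAt p u = 0) : p = 0 := by
  refine MvPolynomial.funext_set (fun _ => Set.range ((↑) : ℝ → ℂ))
    (fun _ => Set.infinite_range_of_injective Complex.ofReal_injective) fun x hx => ?_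
  choose u hu using fun i => hx i (Set.mem_univ i)
  have := h u
  simp only [evalAt, hu] at this
  rw [map_zero]
  exact this

/-- A polynomial that vanishes at all real points off the hyperplane `v = 0` is zero. -/
lemma eq_zero_of_evalAt_eq_zero_of_ne {n : ℕ} {p : MvPolynomial (Fin (n + 1)) ℂ}
    (h : ∀ u : Fin (n + 1) → ℝ, u 0 ≠ 0 → evalAt p u = 0) : p = 0 := by
  have : MvPolynomial.X 0 * p = 0 := by
    refine eq_zero_of_evalAt_eq_zero fun u => ?_
    rw [evalAt_mul]
    by_cases hu : u 0 = 0
    · simp [evalAt, hu]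
    · rw [h u hu, mul_zero]
  simpa [MvPolynomial.X_ne_zero] using this

lemma eq_smul_cons {n : ℕ} {u : Fin (n + 1) → ℝ} (hu : u 0 ≠ 0) :
    u = u 0 • (Fin.cons 1 (fun j => u j.succ / u 0) : Fin (n + 1) → ℝ) := by
  ext i
  refine Fin.cases ?_ (fun j => ?_) i
  · simp
  · simp only [Pi.smul_apply, Fin.cons_succ, smul_eq_mul]
    field_simp

lemma eq_zero_of_evalAt_cons {n : ℕ} {d : ℤ} {p : MvPolynomial (Fin (n + 1)) ℂ}
    (hp : p ∈ Pol n d) (h : ∀ b : Fin n → ℝ, evalAt p (Fin.cons 1 b) = 0) : p = 0 := by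
  refine eq_zero_of_evalAt_eq_zero_of_ne fun u hu => ?_
  rw [eq_smul_cons hu, evalAt_smul hp, h, mul_zero]

/-- For `k ≠ 0` the vectors `b` with `k · b ∉ ℤ` are dense, hence they determine a homogeneous
polynomial through its values at `(1, b)`. -/
lemma eq_zero_of_evalAt_cons_of_ne_int {n : ℕ} {d : ℤ} {p : MvPolynomial (Fin (n + 1)) ℂ}
    (hp : p ∈ Pol n d) {k : Fin n → ℤ} (hk : k ≠ 0)
    (h : ∀ b : Fin n → ℝ, (∀ l : ℤ, ∑ j, (k j : ℝ) * b j ≠ l) → evalAt p (Fin.cons 1 b) = 0) :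
    p = 0 := by
  refine eq_zero_of_evalAt_cons hp fun b => ?_
  have hpos : 0 < ∑ j, (k j : ℝ) * k j := by
    obtain ⟨j, hj⟩ := Function.ne_iff.1 hk
    refine Finset.sum_pos' (fun i _ => mul_self_nonneg _) ⟨j, Finset.mem_univ j, ?_⟩
    exact mul_self_pos.2 (by exact_mod_cast hj)
  set κ := ∑ j, (k j : ℝ) * k j
  set c := ∑ j, (k j : ℝ) * b j
  have hcont : Continuous fun s : ℝ => evalAt p (Fin.cons 1 (b + s • fun j => (k j : ℝ))) := by
    refine (continuous_evalAt p).comp (continuous_pi fun i => ?_)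
    refine Fin.cases ?_ (fun j => ?_) i
    · simp only [Fin.cons_zero]; fun_prop
    · simp only [Fin.cons_succ, Pi.add_apply, Pi.smul_apply, smul_eq_mul]; fun_prop
  have hlim := (hcont.tendsto 0).mono_left (nhdsWithin_le_nhds (s := Set.Ioi 0))
  simp only [zero_smul, add_zero] at hlim
  refine tendsto_nhds_unique_of_eventuallyEq hlim tendsto_const_nhds ?_
  have hη : 0 < (⌊c⌋ + 1 - c) / κ := div_pos (by linarith [Int.lt_floor_add_one c]) hpos
  filter_upwards [Ioo_mem_nhdsGT hη] with s hs
  refine h _ fun l hl => ?_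
  have hsum : ∑ j, (k j : ℝ) * (b + s • fun j => (k j : ℝ)) j = c + s * κ := by
    simp only [Pi.add_apply, Pi.smul_apply, smul_eq_mul, mul_add, Finset.sum_add_distrib, c, κ,
      Finset.mul_sum]
    congr 1
    exact Finset.sum_congr rfl fun j _ => by ring
  rw [hsum] at hl
  have h1 : c < l := by rw [← hl]; linarith [mul_pos hs.1 hpos]
  have h2 : (l : ℝ) < ⌊c⌋ + 1 := by
    rw [← hl]
    have := (lt_div_iff₀ hpos).1 hs.2
    linarith
  have h3 : l < ⌊c⌋ + 1 := by exact_mod_cast h2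
  have h4 : ⌊c⌋ < l := Int.floor_lt.2 h1
  omega

/-! ### Division by linear forms -/

/-- The linear form `∑ᵢ ξᵢ Xᵢ`. -/
def linForm {n : ℕ} (ξ : Fin (n + 1) → ℝ) : MvPolynomial (Fin (n + 1)) ℂ :=
  ∑ i, MvPolynomial.C (ξ i : ℂ) * MvPolynomial.X i

lemma evalAt_linForm {n : ℕ} (ξ u : Fin (n + 1) → ℝ) :
    evalAt (linForm ξ) u = ((∑ i, ξ i * u i : ℝ) : ℂ) := by
  simp [evalAt, linForm]

lemma coeff_linForm_mul {n : ℕ} (ξ : Fin (n + 1) → ℝ) (q : MvPolynomial (Fin (n + 1)) ℂ)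
    (β : Fin (n + 1) →₀ ℕ) :
    (linForm ξ * q).coeff β = ∑ i, (ξ i : ℂ) * (MvPolynomial.X i * q).coeff β := by
  simp only [linForm, Finset.sum_mul, MvPolynomial.coeff_sum, mul_assoc, MvPolynomial.coeff_C_mul]

lemma degree_sub_single {n : ℕ} {β : Fin (n + 1) →₀ ℕ} {i : Fin (n + 1)} (hi : i ∈ β.support) :
    (β - Finsupp.single i 1).degree + 1 = β.degree := by
  have h : β = (β - Finsupp.single i 1) + Finsupp.single i 1 := by
    rw [tsub_add_cancel_of_le]
    rw [Finsupp.single_le_iff]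
    exact Nat.one_le_iff_ne_zero.2 (Finsupp.mem_support_iff.1 hi)
  conv_rhs => rw [h, map_add, Finsupp.degree_single]

lemma sub_single_mem_exps {n : ℕ} {d : ℤ} {β : Fin (n + 1) →₀ ℕ} {i : Fin (n + 1)}
    (hi : i ∈ β.support) : β - Finsupp.single i 1 ∈ exps n (d - 1) ↔ β ∈ exps n d := by
  rw [mem_exps, mem_exps, ← degree_sub_single hi]
  push_cast
  constructor <;> intro h <;> omega

lemma X_mul_mem_pol {n : ℕ} {d : ℤ} {q : MvPolynomial (Fin (n + 1)) ℂ} (hq : q ∈ Pol n (d - 1))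
    (i : Fin (n + 1)) : MvPolynomial.X i * q ∈ Pol n d := by
  classical
  rw [mem_pol_iff]
  intro β hβ
  rw [MvPolynomial.coeff_X_mul'] at hβ
  split_ifs at hβ with hi
  · exact mem_exps.1 ((sub_single_mem_exps hi).1 (mem_exps.2 (mem_pol_iff.1 hq _ hβ)))
  · exact absurd rfl hβ

lemma linForm_mul_mem_pol {n : ℕ} {d : ℤ} {q : MvPolynomial (Fin (n + 1)) ℂ}
    (hq : q ∈ Pol n (d - 1)) (ξ : Fin (n + 1) → ℝ) : linForm ξ * q ∈ Pol n d := by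
  rw [linForm, Finset.sum_mul]
  refine Submodule.sum_mem _ fun i _ => ?_
  rw [mul_assoc, ← MvPolynomial.smul_eq_C_mul]
  exact Submodule.smul_mem _ _ (X_mul_mem_pol hq i)

/-- If a homogeneous polynomial vanishes on the part `v = 1` of the hyperplane `ξ · (v, w) = 0`,
and this hyperplane is not `v = 0`, then it is divisible by the linear form `ξ`: reduce modulo the
form by eliminating a variable `w_j` with `ξ_j ≠ 0`. -/
lemma linForm_dvd {n : ℕ} {d : ℤ} {p : MvPolynomial (Fin (n + 1)) ℂ} (hp : p ∈ Pol n d)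
    {ξ : Fin (n + 1) → ℝ} {j : Fin n} (hj : ξ j.succ ≠ 0)
    (h : ∀ b : Fin n → ℝ, ∑ i, ξ i * (Fin.cons 1 b : Fin (n + 1) → ℝ) i = 0 →
      evalAt p (Fin.cons 1 b) = 0) : linForm ξ ∣ p := by
  classical
  set L := linForm ξ
  -- the projection onto the hyperplane along the axis of `w_j`
  let σ : MvPolynomial (Fin (n + 1)) ℂ →ₐ[ℂ] MvPolynomial (Fin (n + 1)) ℂ :=
    MvPolynomial.aeval fun i => MvPolynomial.X i -
      if i = j.succ then MvPolynomial.C ((ξ j.succ : ℂ)⁻¹) * L else 0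
  have hσ : (Ideal.Quotient.mkₐ ℂ (Ideal.span {L})).comp σ =
      Ideal.Quotient.mkₐ ℂ (Ideal.span {L}) := by
    refine MvPolynomial.algHom_ext fun i => ?_
    simp only [AlgHom.comp_apply, σ, MvPolynomial.aeval_X, map_sub, sub_eq_self]
    rw [Ideal.Quotient.mkₐ_eq_mk, Ideal.Quotient.eq_zero_iff_mem]
    split_ifs
    · exact Ideal.mul_mem_left _ _ (Ideal.mem_span_singleton_self L)
    · exact Ideal.zero_mem _
  have hp0 : σ p = 0 := by
    refine eq_zero_of_evalAt_eq_zero_of_ne fun u hu => ?_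
    set u' : Fin (n + 1) → ℝ := fun i =>
      u i - if i = j.succ then (ξ j.succ)⁻¹ * ∑ i, ξ i * u i else 0
    have h1 : evalAt (σ p) u = evalAt p u' := by
      simp only [evalAt, σ]
      rw [MvPolynomial.aeval_def, MvPolynomial.eval_eval₂]
      rw [MvPolynomial.eval, MvPolynomial.coe_eval₂Hom]
      congr 1
      · ext z; simp
      · funext i
        have := evalAt_linForm ξ u
        simp only [evalAt] at this
        change MvPolynomial.eval _ _ = _
        simp only [map_sub, u']
        split_ifs
        · simp only [MvPolynomial.eval_X, map_mul, MvPolynomial.eval_C, L, this]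
          push_cast; ring
        · simp
    have hu'0 : u' 0 = u 0 := by
      simp only [u']
      rw [if_neg (Fin.succ_ne_zero j).symm, sub_zero]
    have hu' : u' 0 ≠ 0 := by rwa [hu'0]
    rw [h1, eq_smul_cons hu', evalAt_smul hp, h, mul_zero]
    have h2 : ∑ i, ξ i * u' i = 0 := by
      simp only [u', mul_sub, Finset.sum_sub_distrib, mul_ite, mul_zero, Finset.sum_ite_eq',
        Finset.mem_univ, if_true]
      field_simp
      ring
    have h3 : ∑ i, ξ i * u' i = u' 0 * ∑ i, ξ i *
        (Fin.cons 1 (fun j => u' j.succ / u' 0) : Fin (n + 1) → ℝ) i := by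
      conv_lhs => rw [eq_smul_cons hu']
      rw [Finset.mul_sum]
      exact Finset.sum_congr rfl fun i _ => by
        simp only [Pi.smul_apply, smul_eq_mul]
        ring
    rw [h2] at h3
    exact (mul_eq_zero.1 h3.symm).resolve_left hu'
  rw [← Ideal.mem_span_singleton, ← Ideal.Quotient.eq_zero_iff_mem, ← Ideal.Quotient.mkₐ_eq_mk ℂ]
  rw [← hσ, AlgHom.comp_apply, hp0, map_zero]

lemma exists_eq_linForm_mul {n : ℕ} {d : ℤ} {p : MvPolynomial (Fin (n + 1)) ℂ} (hp : p ∈ Pol n d)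
    {ξ : Fin (n + 1) → ℝ} {j : Fin n} (hj : ξ j.succ ≠ 0)
    (h : ∀ b : Fin n → ℝ, ∑ i, ξ i * (Fin.cons 1 b : Fin (n + 1) → ℝ) i = 0 →
      evalAt p (Fin.cons 1 b) = 0) : ∃ q : Pol n (d - 1), p = linForm ξ * q := by
  classical
  obtain ⟨q, hq⟩ := linForm_dvd hp hj h
  -- only the part of degree `d - 1` of the quotient contributes
  refine ⟨ofCoeffs n (d - 1) q.coeff, ?_⟩
  ext β
  by_cases hβ : β ∈ exps n d
  · rw [hq, coeff_linForm_mul, coeff_linForm_mul]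
    refine Finset.sum_congr rfl fun i _ => ?_
    rw [MvPolynomial.coeff_X_mul', MvPolynomial.coeff_X_mul']
    split_ifs with hi
    · rw [coeff_ofCoeffs, if_pos ((sub_single_mem_exps hi).2 hβ)]
    · rfl
  · rw [coeff_eq_zero_of_notMem_exps hp hβ,
      coeff_eq_zero_of_notMem_exps (linForm_mul_mem_pol (Subtype.prop _) ξ) hβ]

lemma linForm_ne_zero {n : ℕ} {ξ : Fin (n + 1) → ℝ} (hξ : ξ ≠ 0) : linForm ξ ≠ 0 := by
  intro h
  have h2 := evalAt_linForm ξ ξ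
  rw [h] at h2
  simp only [evalAt, map_zero] at h2
  have h3 : ∑ i, ξ i * ξ i = 0 := by exact_mod_cast h2.symm
  rw [Finset.sum_eq_zero_iff_of_nonneg fun i _ => mul_self_nonneg _] at h3
  exact hξ (funext fun i => mul_self_eq_zero.1 (h3 i (Finset.mem_univ i)))

/-! ### Norms of polynomials -/

/-- The sum of the squares of the absolute values of the coefficients. -/
def coeffNormSq {n : ℕ} (d : ℤ) (p : MvPolynomial (Fin (n + 1)) ℂ) : ℝ :=
  ∑ α ∈ exps n d, ‖p.coeff α‖ ^ 2

lemma coeffNormSq_nonneg {n : ℕ} (d : ℤ) (p : MvPolynomial (Fin (n + 1)) ℂ) :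
    0 ≤ coeffNormSq d p := Finset.sum_nonneg fun _ _ => sq_nonneg _

lemma coeffNormSq_pos {n : ℕ} {d : ℤ} {p : MvPolynomial (Fin (n + 1)) ℂ} (hp : p ∈ Pol n d)
    (h : p ≠ 0) : 0 < coeffNormSq d p := by
  obtain ⟨α, hα⟩ := MvPolynomial.ne_zero_iff.1 h
  exact Finset.sum_pos' (fun _ _ => sq_nonneg _)
    ⟨α, mem_exps.2 (mem_pol_iff.1 hp α hα), by positivity⟩

/-- A continuous positive function on a product of two finite-dimensional spaces which is
homogeneous of degree 2 in each variable is bounded below by a multiple of `‖x‖² ‖y‖²`. -/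
lemma exists_lower_bound {E F : Type*} [NormedAddCommGroup E] [NormedSpace ℝ E] [ProperSpace E]
    [NormedAddCommGroup F] [NormedSpace ℝ F] [ProperSpace F] {Φ : E → F → ℝ}
    (hc : Continuous fun z : E × F => Φ z.1 z.2)
    (hs : ∀ (s t : ℝ) x y, Φ (s • x) (t • y) = s ^ 2 * t ^ 2 * Φ x y)
    (hpos : ∀ x y, x ≠ 0 → y ≠ 0 → 0 < Φ x y) :
    ∃ C : ℝ, 0 ≤ C ∧ ∀ x y, ‖x‖ ^ 2 * ‖y‖ ^ 2 ≤ C * Φ x y := by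
  have hzero : ∀ x y, x = 0 ∨ y = 0 → Φ x y = 0 := by
    rintro x y (rfl | rfl)
    · simpa using hs 0 1 0 y
    · simpa using hs 1 0 x 0
  set K := Metric.sphere (0 : E) 1 ×ˢ Metric.sphere (0 : F) 1
  have hK : IsCompact K := (isCompact_sphere _ _).prod (isCompact_sphere _ _)
  obtain hne | hne := K.eq_empty_or_nonempty
  · refine ⟨0, le_rfl, fun x y => ?_⟩
    by_cases hx : x = 0
    · simp [hx]
    by_cases hy : y = 0
    · simp [hy]
    have : (‖x‖⁻¹ • x, ‖y‖⁻¹ • y) ∈ K := by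
      constructor <;> simp [norm_smul, norm_ne_zero_iff.2, hx, hy]
    rw [hne] at this
    exact absurd this (Set.notMem_empty _)
  · obtain ⟨z, hz, hmin⟩ := hK.exists_isMinOn hne hc.continuousOn
    have hz1 : z.1 ≠ 0 := by
      intro h; have := hz.1; simp [h] at this
    have hz2 : z.2 ≠ 0 := by
      intro h; have := hz.2; simp [h] at this
    have hmpos := hpos z.1 z.2 hz1 hz2
    refine ⟨(Φ z.1 z.2)⁻¹, by positivity, fun x y => ?_⟩
    by_cases hx : x = 0
    · simp [hx, hzero 0 y]
    by_cases hy : y = 0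
    · simp [hy, hzero x 0]
    have hmem : (‖x‖⁻¹ • x, ‖y‖⁻¹ • y) ∈ K := by
      constructor <;> simp [norm_smul, norm_ne_zero_iff.2, hx, hy]
    have h1 : Φ z.1 z.2 ≤ Φ (‖x‖⁻¹ • x) (‖y‖⁻¹ • y) := hmin hmem
    rw [hs] at h1
    have hx' : 0 < ‖x‖ := norm_pos_iff.2 hx
    have hy' : 0 < ‖y‖ := norm_pos_iff.2 hy
    rw [inv_mul_eq_div, le_div_iff₀ hmpos]
    calc ‖x‖ ^ 2 * ‖y‖ ^ 2 * Φ z.1 z.2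
        ≤ ‖x‖ ^ 2 * ‖y‖ ^ 2 * (‖x‖⁻¹ ^ 2 * ‖y‖⁻¹ ^ 2 * Φ x y) := by gcongr
      _ = Φ x y := by field_simp

/-- Extension by zero of a family of coefficients. -/
def extendCoeffs {n : ℕ} {d : ℤ} (c : EuclideanSpace ℂ (exps n d)) (α : Fin (n + 1) →₀ ℕ) : ℂ :=
  if h : α ∈ exps n d then c ⟨α, h⟩ else 0

lemma continuous_extendCoeffs {n : ℕ} {d : ℤ} (α : Fin (n + 1) →₀ ℕ) :
    Continuous fun c : EuclideanSpace ℂ (exps n d) => extendCoeffs c α := by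
  unfold extendCoeffs
  split_ifs with h <;> fun_prop

lemma extendCoeffs_smul {n : ℕ} {d : ℤ} (t : ℝ) (c : EuclideanSpace ℂ (exps n d))
    (α : Fin (n + 1) →₀ ℕ) : extendCoeffs (t • c) α = t * extendCoeffs c α := by
  unfold extendCoeffs
  split_ifs with h
  · simp
  · simp

lemma ofCoeffs_extendCoeffs_smul {n : ℕ} {d : ℤ} (t : ℝ) (c : EuclideanSpace ℂ (exps n d)) :
    (ofCoeffs n d (extendCoeffs (t • c)) : MvPolynomial (Fin (n + 1)) ℂ) =
      MvPolynomial.C (t : ℂ) *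
        (ofCoeffs n d (extendCoeffs c) : MvPolynomial (Fin (n + 1)) ℂ) := by
  ext α
  rw [MvPolynomial.coeff_C_mul, coeff_ofCoeffs, coeff_ofCoeffs, extendCoeffs_smul]
  split_ifs <;> simp

lemma exists_extendCoeffs_eq {n : ℕ} {d : ℤ} (p : Pol n d) :
    ∃ c : EuclideanSpace ℂ (exps n d), ofCoeffs n d (extendCoeffs c) = p ∧
      ‖c‖ ^ 2 = coeffNormSq d (p : MvPolynomial (Fin (n + 1)) ℂ) := by
  refine ⟨WithLp.toLp 2 fun α => (p : MvPolynomial (Fin (n + 1)) ℂ).coeff α, ?_, ?_⟩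
  · ext α
    rw [coeff_ofCoeffs]
    split_ifs with h
    · simp [extendCoeffs, h]
    · rw [coeff_eq_zero_of_notMem_exps p.2 h]
  · rw [EuclideanSpace.norm_sq_eq, coeffNormSq,
      ← Finset.sum_coe_sort (exps n d) fun α =>
        ‖(p : MvPolynomial (Fin (n + 1)) ℂ).coeff α‖ ^ 2]

lemma ofCoeffs_extendCoeffs_ne_zero {n : ℕ} {d : ℤ} {c : EuclideanSpace ℂ (exps n d)}
    (hc : c ≠ 0) : (ofCoeffs n d (extendCoeffs c) : MvPolynomial (Fin (n + 1)) ℂ) ≠ 0 := by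
  intro h
  apply hc
  ext α
  have := congrArg (MvPolynomial.coeff α.1) h
  rw [coeff_ofCoeffs, if_pos α.2] at this
  simpa [extendCoeffs] using this

/-- Multiplication of homogeneous polynomials by linear forms is bounded below, uniformly in the
form. -/
lemma exists_division_bound (n : ℕ) (d : ℤ) :
    ∃ C : ℝ, 0 ≤ C ∧ ∀ (ξ : Fin (n + 1) → ℝ) (q : Pol n (d - 1)),
      (∑ i, ξ i ^ 2) * coeffNormSq (d - 1) (q : MvPolynomial (Fin (n + 1)) ℂ) ≤
        C * coeffNormSq d (linForm ξ * (q : MvPolynomial (Fin (n + 1)) ℂ)) := by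
  classical
  refine (exists_lower_bound (E := EuclideanSpace ℝ (Fin (n + 1)))
    (F := EuclideanSpace ℂ (exps n (d - 1)))
    (Φ := fun ξ c => coeffNormSq d (linForm (fun i => ξ i) *
      (ofCoeffs n (d - 1) (extendCoeffs c) : MvPolynomial (Fin (n + 1)) ℂ)))
    ?_ ?_ ?_).imp fun C hC => ⟨hC.1, fun ξ q => ?_⟩
  · unfold coeffNormSq
    refine continuous_finsetSum _ fun β _ => ?_
    refine (Continuous.norm ?_).pow 2
    simp only [coeff_linForm_mul, MvPolynomial.coeff_X_mul', coeff_ofCoeffs]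
    refine continuous_finsetSum _ fun i _ => Continuous.mul (by fun_prop) ?_
    split_ifs
    · exact (continuous_extendCoeffs _).comp continuous_snd
    all_goals exact continuous_const
  · intro s t ξ c
    have : linForm (fun i => (s • ξ) i) = MvPolynomial.C (s : ℂ) * linForm (fun i => ξ i) := by
      simp [linForm, Finset.mul_sum, mul_assoc]
    simp only [this, ofCoeffs_extendCoeffs_smul, coeffNormSq, Finset.mul_sum]
    refine Finset.sum_congr rfl fun β _ => ?_
    rw [show ∀ a b c e : MvPolynomial (Fin (n + 1)) ℂ, a * b * (c * e) = a * (c * (b * e)) by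
      intros; ring, MvPolynomial.coeff_C_mul, MvPolynomial.coeff_C_mul]
    simp [mul_pow]
    ring
  · intro ξ c hξ hc
    refine coeffNormSq_pos (linForm_mul_mem_pol (Subtype.prop _) _) ?_
    refine mul_ne_zero (linForm_ne_zero fun h => hξ ?_) (ofCoeffs_extendCoeffs_ne_zero hc)
    ext i
    exact congrFun h i
  · obtain ⟨c, hc, hn⟩ := exists_extendCoeffs_eq q
    have := hC.2 (WithLp.toLp 2 ξ) c
    rw [EuclideanSpace.norm_sq_eq, hn, hc] at this
    simpa using this

lemma polNormSq_nonneg {n : ℕ} (p : MvPolynomial (Fin (n + 1)) ℂ) : 0 ≤ polNormSq p :=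
  integral_nonneg fun _ => by positivity

lemma exists_polNormSq_le (n : ℕ) (d : ℤ) :
    ∃ A : ℝ, 0 ≤ A ∧ ∀ p ∈ Pol n d, polNormSq p ≤ A * coeffNormSq d p := by
  set μ := (volume : Measure (EuclideanSpace ℝ (Fin (n + 1)))).toSphere
  refine ⟨(exps n d).card * μ.real Set.univ, by positivity, fun p hp => ?_⟩
  have hb : ∀ u : Metric.sphere (0 : EuclideanSpace ℝ (Fin (n + 1))) 1,
      ‖evalAt p (fun i => (u : EuclideanSpace ℝ (Fin (n + 1))) i)‖ ^ 2 ≤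
        (exps n d).card * coeffNormSq d p := by
    intro u
    have hu : ∀ i, |(u : EuclideanSpace ℝ (Fin (n + 1))) i| ≤ 1 := fun i => by
      have := PiLp.norm_apply_le (u : EuclideanSpace ℝ (Fin (n + 1))) i
      rwa [mem_sphere_zero_iff_norm.1 u.2, Real.norm_eq_abs] at this
    have h1 : ‖evalAt p (fun i => (u : EuclideanSpace ℝ (Fin (n + 1))) i)‖ ≤
        ∑ α ∈ exps n d, ‖p.coeff α‖ := by
      rw [evalAt_eq_sum hp]
      refine norm_sum_le_of_le _ fun α _ => ?_
      rw [norm_mul, norm_prod]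
      refine mul_le_of_le_one_right (norm_nonneg _) (Finset.prod_le_one (fun _ _ => norm_nonneg _)
        fun i _ => ?_)
      rw [norm_pow, Complex.norm_real]
      exact pow_le_one₀ (norm_nonneg _) (hu i)
    calc _ ≤ (∑ α ∈ exps n d, ‖p.coeff α‖) ^ 2 := by gcongr
      _ ≤ _ := sq_sum_le_card_mul_sum_sq
  calc polNormSq p ≤ ∫ u, (exps n d).card * coeffNormSq d p ∂μ :=
        integral_mono_of_nonneg (ae_of_all _ fun _ => by positivity) (integrable_const _)
          (ae_of_all _ hb)
    _ = _ := by rw [integral_const, smul_eq_mul]; ring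

lemma continuous_polNormSq_ofCoeffs (n : ℕ) (d : ℤ) :
    Continuous fun c : EuclideanSpace ℂ (exps n d) =>
      polNormSq (ofCoeffs n d (extendCoeffs c) : MvPolynomial (Fin (n + 1)) ℂ) := by
  unfold polNormSq
  simp_rw [← setIntegral_univ (μ := (volume : Measure (EuclideanSpace ℝ (Fin (n + 1)))).toSphere)]
  refine continuous_parametric_integral_of_continuous ?_ isCompact_univ
  refine (Continuous.norm ?_).pow 2
  have : ∀ z : EuclideanSpace ℂ (exps n d) × Metric.sphere (0 : EuclideanSpace ℝ (Fin (n + 1))) 1,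
      evalAt (ofCoeffs n d (extendCoeffs z.1) : MvPolynomial (Fin (n + 1)) ℂ)
        (fun i => (z.2 : EuclideanSpace ℝ (Fin (n + 1))) i) =
      ∑ α ∈ exps n d, extendCoeffs z.1 α *
        ∏ i, (((z.2 : EuclideanSpace ℝ (Fin (n + 1))) i : ℝ) : ℂ) ^ α i := by
    intro z
    rw [evalAt_eq_sum (Subtype.prop _)]
    refine Finset.sum_congr rfl fun α hα => ?_
    rw [coeff_ofCoeffs, if_pos hα]
  simp only [this]
  refine continuous_finsetSum _ fun α _ => ?_
  exact ((continuous_extendCoeffs α).comp continuous_fst).mul (by fun_prop)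

lemma polNormSq_pos {n : ℕ} {d : ℤ} {p : MvPolynomial (Fin (n + 1)) ℂ} (hp : p ∈ Pol n d)
    (h : p ≠ 0) : 0 < polNormSq p := by
  have hc : Continuous fun u : Metric.sphere (0 : EuclideanSpace ℝ (Fin (n + 1))) 1 =>
      ‖evalAt p (fun i => (u : EuclideanSpace ℝ (Fin (n + 1))) i)‖ ^ 2 :=
    ((continuous_evalAt p).comp (by fun_prop)).norm.pow 2
  obtain ⟨u, hu⟩ : ∃ u : Metric.sphere (0 : EuclideanSpace ℝ (Fin (n + 1))) 1,
      evalAt p (fun i => (u : EuclideanSpace ℝ (Fin (n + 1))) i) ≠ 0 := by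
    by_contra! hcon
    refine h (eq_zero_of_evalAt_eq_zero_of_ne fun u hu => ?_)
    set x : EuclideanSpace ℝ (Fin (n + 1)) := WithLp.toLp 2 u
    have hx : x ≠ 0 := fun hx => hu (by simpa [x] using congrArg (fun y => y 0) hx)
    have := hcon ⟨‖x‖⁻¹ • x, by simp [norm_smul, norm_ne_zero_iff.2 hx]⟩
    have h2 : u = ‖x‖ • fun i => (‖x‖⁻¹ • x) i := by
      ext i
      simp [x, mul_inv_cancel_left₀ (norm_ne_zero_iff.2 hx)]
    rw [h2, evalAt_smul hp, this, mul_zero]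
  exact hc.integral_pos_of_hasCompactSupport_nonneg_nonzero
    (HasCompactSupport.of_compactSpace _) (fun _ => by positivity) (x := u) (by positivity)

lemma polNormSq_C_mul {n : ℕ} (t : ℂ) (p : MvPolynomial (Fin (n + 1)) ℂ) :
    polNormSq (MvPolynomial.C t * p) = ‖t‖ ^ 2 * polNormSq p := by
  simp only [polNormSq, evalAt_mul, norm_mul, mul_pow, ← integral_const_mul]
  simp [evalAt]

lemma exists_coeffNormSq_le (n : ℕ) (d : ℤ) :
    ∃ B : ℝ, 0 ≤ B ∧ ∀ p : Pol n d, coeffNormSq d (p : MvPolynomial (Fin (n + 1)) ℂ) ≤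
      B * polNormSq (p : MvPolynomial (Fin (n + 1)) ℂ) := by
  refine (exists_lower_bound (E := ℝ) (F := EuclideanSpace ℂ (exps n d))
    (Φ := fun s c => s ^ 2 *
      polNormSq (ofCoeffs n d (extendCoeffs c) : MvPolynomial (Fin (n + 1)) ℂ))
    ?_ ?_ ?_).imp fun C hC => ⟨hC.1, fun p => ?_⟩
  · exact (continuous_fst.pow 2).mul ((continuous_polNormSq_ofCoeffs n d).comp continuous_snd)
  · intro s t x c
    simp only [ofCoeffs_extendCoeffs_smul, polNormSq_C_mul, Complex.norm_real, Real.norm_eq_abs,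
      sq_abs, smul_eq_mul]
    ring
  · intro s c hs hc
    exact mul_pos (by positivity)
      (polNormSq_pos (Subtype.prop _) (ofCoeffs_extendCoeffs_ne_zero hc))
  · obtain ⟨c, hc, hn⟩ := exists_extendCoeffs_eq p
    simpa [hn, hc] using hC.2 1 c

/-! ### Fourier series on the slab -/

instance : IsProbabilityMeasure (volume : Measure UnitAddCircle) :=
  ⟨UnitAddCircle.measure_univ⟩

/-- The plane wave `exp (2πi (θ x + k · y))`, where the frequency `θ` in the direction transversal
to the boundary need not be an integer. -/
def wave {n : ℕ} (θ : ℝ) (k : Fin n → ℤ) (p : Cylinder n) : ℂ :=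
  Complex.exp (2 * Real.pi * Complex.I * θ * p.1) * UnitAddTorus.mFourier k p.2

lemma continuous_wave {n : ℕ} (θ : ℝ) (k : Fin n → ℤ) : Continuous (wave θ k) := by
  unfold wave; fun_prop

lemma continuous_toCylinder {n : ℕ} : Continuous (toCylinder : Slab n → Cylinder n) := by
  unfold toCylinder; fun_prop

lemma conj_wave {n : ℕ} (θ : ℝ) (k : Fin n → ℤ) (p : Cylinder n) :
    conj (wave θ k p) = wave (-θ) (-k) p := by
  rw [wave, wave, UnitAddTorus.mFourier_neg, map_mul, ← Complex.exp_conj]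
  congr 2
  simp [Complex.conj_ofNat]

lemma wave_mul {n : ℕ} (θ η : ℝ) (k l : Fin n → ℤ) (p : Cylinder n) :
    wave θ k p * wave η l p = wave (θ + η) (k + l) p := by
  rw [wave, wave, wave, UnitAddTorus.mFourier_add,
    show 2 * (Real.pi : ℂ) * Complex.I * ((θ + η : ℝ) : ℂ) * p.1 =
      2 * Real.pi * Complex.I * θ * p.1 + 2 * Real.pi * Complex.I * η * p.1 by push_cast; ring,
    Complex.exp_add]
  ring

lemma norm_mFourier_apply {n : ℕ} (k : Fin n → ℤ) (y : UnitAddTorus (Fin n)) :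
    ‖UnitAddTorus.mFourier k y‖ = 1 := by
  simp [UnitAddTorus.mFourier, norm_prod, fourier_apply, Circle.norm_coe]

lemma norm_wave {n : ℕ} (θ : ℝ) (k : Fin n → ℤ) (p : Cylinder n) : ‖wave θ k p‖ = 1 := by
  rw [wave, norm_mul, norm_mFourier_apply, mul_one,
    show 2 * (Real.pi : ℂ) * Complex.I * θ * p.1 = ((2 * Real.pi * θ * p.1 : ℝ) : ℂ) * Complex.I by
      push_cast; ring, Complex.norm_exp_ofReal_mul_I]

lemma integral_mFourier {n : ℕ} {k : Fin n → ℤ} (hk : k ≠ 0) :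
    ∫ y : UnitAddTorus (Fin n), UnitAddTorus.mFourier k y = 0 := by
  classical
  obtain ⟨j, hj⟩ := Function.ne_iff.1 hk
  -- translation by half a period in a direction with `k j ≠ 0` changes the sign
  set c : UnitAddTorus (Fin n) := Pi.single j ((1 / 2 / (k j) : ℝ) : UnitAddCircle)
  have h1 : ∀ y, UnitAddTorus.mFourier k (y + c) = -UnitAddTorus.mFourier k y := by
    intro y
    simp only [UnitAddTorus.mFourier, ContinuousMap.coe_mk]
    rw [← Finset.mul_prod_erase _ _ (Finset.mem_univ j),
      ← Finset.mul_prod_erase _ _ (Finset.mem_univ j), ← neg_mul]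
    congr 1
    · simp only [Pi.add_apply, c, Pi.single_eq_same]
      exact fourier_add_half_inv_index hj one_pos _
    · refine Finset.prod_congr rfl fun i hi => ?_
      simp [c, Pi.single_eq_of_ne (Finset.ne_of_mem_erase hi)]
  have h2 := integral_add_right_eq_self (μ := (volume : Measure (UnitAddTorus (Fin n))))
    (fun y => UnitAddTorus.mFourier k y) c
  simp only [h1, integral_neg] at h2
  exact self_eq_neg.1 h2.symm

lemma integral_mFourier_zero {n : ℕ} :
    ∫ y : UnitAddTorus (Fin n), UnitAddTorus.mFourier 0 y = 1 := by
  simp [UnitAddTorus.mFourier_zero]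

lemma integral_exp_unitInterval {θ : ℝ} (hθ : θ ≠ 0) :
    ∫ t : unitInterval, Complex.exp (2 * Real.pi * Complex.I * θ * (t : ℝ)) =
      (Complex.exp (2 * Real.pi * Complex.I * θ) - 1) / (2 * Real.pi * Complex.I * θ) := by
  have hc : 2 * (Real.pi : ℂ) * Complex.I * θ ≠ 0 := by
    simp [Real.pi_ne_zero, hθ]
  have h := integral_subtype_comap (μ := (volume : Measure ℝ)) (s := unitInterval)
    measurableSet_Icc (fun t : ℝ => Complex.exp (2 * Real.pi * Complex.I * θ * t))
  refine h.trans ?_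
  rw [integral_Icc_eq_integral_Ioc, ← intervalIntegral.integral_of_le zero_le_one,
    integral_exp_mul_complex hc]
  simp

lemma integral_wave_prod {n : ℕ} (θ : ℝ) (k : Fin n → ℤ) :
    ∫ z : Slab n, wave θ k (toCylinder z) =
      (∫ t : unitInterval, Complex.exp (2 * Real.pi * Complex.I * θ * (t : ℝ))) *
        ∫ y : UnitAddTorus (Fin n), UnitAddTorus.mFourier k y := by
  exact integral_prod_mul (μ := (volume : Measure unitInterval))
    (ν := (volume : Measure (UnitAddTorus (Fin n))))
    (fun t : unitInterval => Complex.exp (2 * Real.pi * Complex.I * θ * (t : ℝ)))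
    (fun y => UnitAddTorus.mFourier k y)

lemma integral_wave_of_ne {n : ℕ} (θ : ℝ) {k : Fin n → ℤ} (hk : k ≠ 0) :
    ∫ z : Slab n, wave θ k (toCylinder z) = 0 := by
  rw [integral_wave_prod, integral_mFourier hk, mul_zero]

lemma integral_wave_zero {n : ℕ} {θ : ℝ} (hθ : θ ≠ 0) :
    ∫ z : Slab n, wave θ 0 (toCylinder z) =
      (Complex.exp (2 * Real.pi * Complex.I * θ) - 1) / (2 * Real.pi * Complex.I * θ) := by
  rw [integral_wave_prod, integral_mFourier_zero, mul_one, integral_exp_unitInterval hθ]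

/-- The Fourier character of frequency `ξ ∈ ℤⁿ⁺¹` on the slab. -/
def chr {n : ℕ} (ξ : Fin (n + 1) → ℤ) (z : Slab n) : ℂ :=
  wave (ξ 0) (Fin.tail ξ) (toCylinder z)

lemma continuous_chr {n : ℕ} (ξ : Fin (n + 1) → ℤ) : Continuous (chr ξ) :=
  (continuous_wave _ _).comp continuous_toCylinder

lemma conj_chr {n : ℕ} (ξ : Fin (n + 1) → ℤ) (z : Slab n) : conj (chr ξ z) = chr (-ξ) z := by
  rw [chr, conj_wave, chr]
  simp only [Pi.neg_apply, Int.cast_neg]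
  rfl

lemma integral_chr {n : ℕ} (ξ : Fin (n + 1) → ℤ) :
    ∫ z, chr ξ z = if ξ = 0 then 1 else 0 := by
  unfold chr
  split_ifs with h
  · subst h
    rw [integral_wave_prod]
    have : Fin.tail (0 : Fin (n + 1) → ℤ) = 0 := rfl
    rw [this, integral_mFourier_zero]
    simp
  · by_cases ht : Fin.tail ξ = 0
    · have h0 : ξ 0 ≠ 0 := by
        intro h0
        apply h
        rw [← Fin.cons_self_tail ξ, h0, ht]
        ext i
        refine Fin.cases ?_ (fun j => ?_) i <;> simp
      rw [ht, integral_wave_zero (by exact_mod_cast h0)]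
      have := Complex.exp_int_mul_two_pi_mul_I (ξ 0)
      rw [show 2 * (Real.pi : ℂ) * Complex.I * ((ξ 0 : ℝ) : ℂ) = ξ 0 * (2 * Real.pi * Complex.I) by
        push_cast; ring, this]
      simp
    · rw [integral_wave_of_ne _ ht]

lemma chr_mul {n : ℕ} (ξ η : Fin (n + 1) → ℤ) (z : Slab n) :
    chr ξ z * chr η z = chr (ξ + η) z := by
  rw [chr, chr, wave_mul, chr]
  simp only [Pi.add_apply, Int.cast_add]
  rfl

lemma memLp_of_continuous {X : Type*} [TopologicalSpace X] [CompactSpace X] [MeasurableSpace X]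
    [BorelSpace X] [SecondCountableTopology X] {μ : Measure X} [IsFiniteMeasure μ]
    {F : X → ℂ} (hF : Continuous F) (p : ENNReal) : MemLp F p μ := by
  obtain ⟨C, hC⟩ := isCompact_univ.exists_bound_of_continuousOn hF.continuousOn
  exact MemLp.of_bound hF.aestronglyMeasurable C (ae_of_all _ fun x => hC x (Set.mem_univ x))

/-- The Fourier coefficients of a function on the slab. -/
def fourierCoef {n : ℕ} (F : Slab n → ℂ) (ξ : Fin (n + 1) → ℤ) : ℂ :=
  ∫ z, conj (chr ξ z) * F z

/-- A square integrable function on the torus that is orthogonal to all characters vanishes. -/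
lemma ae_eq_zero_of_integral_conj_mFourier {d : Type*} [Fintype d] {F : UnitAddTorus d → ℂ}
    (hF : MemLp F 2 volume) (h : ∀ ξ, ∫ τ, conj (UnitAddTorus.mFourier ξ τ) * F τ = 0) :
    F =ᵐ[volume] 0 := by
  set E : (d → ℤ) → Lp ℂ 2 (volume : Measure (UnitAddTorus d)) := fun ξ =>
    ContinuousMap.toLp (E := ℂ) 2 volume ℂ (UnitAddTorus.mFourier ξ)
  have hspan : (Submodule.span ℂ (Set.range E)).topologicalClosure = ⊤ := by
    have := (ContinuousMap.toLp_denseRange (p := 2) (μ := (volume : Measure (UnitAddTorus d)))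
      ℂ ℂ (by simp)).topologicalClosure_map_submodule UnitAddTorus.span_mFourier_closure_eq_top
    simpa only [Submodule.map_span, ContinuousLinearMap.coe_coe, ← Set.range_comp,
      Function.comp_def] using this
  have horth : hF.toLp F ∈ (Submodule.span ℂ (Set.range E))ᗮ := by
    rw [Submodule.mem_orthogonal]
    intro u hu
    induction hu using Submodule.span_induction with
    | mem x hx =>
      obtain ⟨ξ, rfl⟩ := hx
      rw [L2.inner_def, ← h ξ]
      refine integral_congr_ae ?_
      filter_upwards [hF.coeFn_toLp, ContinuousMap.coeFn_toLp (p := 2) (𝕜 := ℂ) volume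
        (UnitAddTorus.mFourier ξ)] with τ h1 h2
      rw [h1, h2, RCLike.inner_apply, mul_comm]
    | zero => simp
    | add x y _ _ hx hy => rw [inner_add_left, hx, hy, add_zero]
    | smul a x _ hx => rw [inner_smul_left, hx, mul_zero]
  rw [(Submodule.topologicalClosure_eq_top_iff).1 hspan, Submodule.mem_bot] at horth
  have := hF.coeFn_toLp
  rw [horth] at this
  exact this.symm.trans (Lp.coeFn_zero _ _ _)

/-- The map from the circle to `[0,1]` that inverts the quotient map `t ↦ t mod 1`. -/
def circleToInterval (x : UnitAddCircle) : unitInterval :=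
  ⟨AddCircle.equivIoc 1 0 x, by
    have := (AddCircle.equivIoc (1 : ℝ) 0 x).2
    exact ⟨this.1.le, by simpa using this.2⟩⟩

lemma coe_circleToInterval (x : UnitAddCircle) :
    (((circleToInterval x : unitInterval) : ℝ) : UnitAddCircle) = x :=
  (AddCircle.equivIoc (1 : ℝ) 0).symm_apply_apply x

lemma measurePreserving_circleToInterval : MeasurePreserving circleToInterval := by
  have h1 := AddCircle.measurePreserving_equivIoc (T := 1) (a := 0)
  have hm : Measurable circleToInterval :=
    (measurable_subtype_coe.comp h1.measurable).subtype_mk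
  refine ⟨hm, ?_⟩
  have h2 : Measure.map ((↑) : unitInterval → ℝ) (Measure.map circleToInterval volume) =
      Measure.map ((↑) : unitInterval → ℝ) volume := by
    rw [Measure.map_map measurable_subtype_coe hm, unitInterval.measurePreserving_coe.map_eq,
      show ((↑) : unitInterval → ℝ) ∘ circleToInterval =
        ((↑) : Set.Ioc (0 : ℝ) (0 + 1) → ℝ) ∘ AddCircle.equivIoc 1 0 from rfl,
      ← Measure.map_map measurable_subtype_coe h1.measurable, h1.map_eq,
      map_comap_subtype_coe measurableSet_Ioc, zero_add]
    exact Measure.restrict_congr_set Ioc_ae_eq_Icc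
  have h3 := congrArg (Measure.comap ((↑) : unitInterval → ℝ)) h2
  rwa [unitInterval.measurableEmbedding_coe.comap_map,
    unitInterval.measurableEmbedding_coe.comap_map] at h3

/-- The identification, up to a null set, of the torus of dimension `n + 1` with the slab. -/
def torusToSlab {n : ℕ} (τ : UnitAddTorus (Fin (n + 1))) : Slab n :=
  (circleToInterval (τ 0), fun j => τ j.succ)

lemma measurePreserving_torusToSlab {n : ℕ} :
    MeasurePreserving (torusToSlab : UnitAddTorus (Fin (n + 1)) → Slab n) := by
  have h1 := volume_preserving_piFinSuccAbove (fun _ : Fin (n + 1) => UnitAddCircle) 0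
  have h2 := measurePreserving_circleToInterval.prod
    (MeasurePreserving.id (volume : Measure (UnitAddTorus (Fin n))))
  exact h2.comp h1

lemma chr_torusToSlab {n : ℕ} (ξ : Fin (n + 1) → ℤ) (τ : UnitAddTorus (Fin (n + 1))) :
    chr ξ (torusToSlab τ) = UnitAddTorus.mFourier ξ τ := by
  simp only [chr, wave, UnitAddTorus.mFourier, ContinuousMap.coe_mk, Fin.prod_univ_succ]
  congr 1
  conv_rhs => rw [← coe_circleToInterval (τ 0), fourier_coe_apply]
  simp [toCylinder, torusToSlab]

lemma ae_eq_zero_of_fourierCoef_eq_zero {n : ℕ} {F : Slab n → ℂ} (hF : MemLp F 2 volume)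
    (h : ∀ ξ, fourierCoef F ξ = 0) : F =ᵐ[volume] 0 := by
  have hm := measurePreserving_torusToSlab (n := n)
  have h0 : F ∘ torusToSlab =ᵐ[volume] 0 := by
    refine ae_eq_zero_of_integral_conj_mFourier (hF.comp_measurePreserving hm) fun ξ => ?_
    rw [← h ξ, fourierCoef, ← hm.map_eq, integral_map hm.aemeasurable]
    · simp only [chr_torusToSlab, Function.comp_apply]
    · rw [hm.map_eq]
      exact ((continuous_chr ξ).star.aestronglyMeasurable).mul hF.1
  rw [← eLpNorm_eq_zero_iff hF.1 two_ne_zero, ← eLpNorm_comp_measurePreserving hF.1 hm]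
  rw [eLpNorm_congr_ae h0]
  simp

/-- The characters as elements of `L²`. -/
def chrL2 {n : ℕ} (ξ : Fin (n + 1) → ℤ) : Lp ℂ 2 (volume : Measure (Slab n)) :=
  (memLp_of_continuous (continuous_chr ξ) 2).toLp (chr ξ)

lemma inner_chrL2 {n : ℕ} (ξ : Fin (n + 1) → ℤ) {F : Slab n → ℂ} (hF : MemLp F 2 volume) :
    inner ℂ (chrL2 ξ) (hF.toLp F) = fourierCoef F ξ := by
  rw [L2.inner_def, fourierCoef]
  refine integral_congr_ae ?_
  filter_upwards [hF.coeFn_toLp, MemLp.coeFn_toLp (memLp_of_continuous (continuous_chr ξ) 2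
    (μ := (volume : Measure (Slab n))))] with z h1 h2
  rw [chrL2, h1, h2, RCLike.inner_apply, mul_comm]

lemma orthonormal_chrL2 {n : ℕ} : Orthonormal ℂ (chrL2 (n := n)) := by
  classical
  rw [orthonormal_iff_ite]
  intro ξ η
  rw [show chrL2 η = (memLp_of_continuous (continuous_chr η) 2).toLp (chr η) from rfl,
    inner_chrL2, fourierCoef]
  simp only [conj_chr, chr_mul, integral_chr]
  simp only [neg_add_eq_zero]

/-- The characters form a Hilbert basis of `L²(M)`. -/
def chrBasis (n : ℕ) : HilbertBasis (Fin (n + 1) → ℤ) ℂ (Lp ℂ 2 (volume : Measure (Slab n))) :=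
  HilbertBasis.mkOfOrthogonalEqBot orthonormal_chrL2 (by
    rw [Submodule.eq_bot_iff]
    intro F hF
    rw [Submodule.mem_orthogonal] at hF
    have h : ∀ ξ, fourierCoef F ξ = 0 := fun ξ => by
      rw [← inner_chrL2 ξ (Lp.memLp F), Lp.toLp_coeFn]
      exact hF _ (Submodule.subset_span ⟨ξ, rfl⟩)
    rw [Lp.eq_zero_iff_ae_eq_zero]
    exact ae_eq_zero_of_fourierCoef_eq_zero (Lp.memLp F) h)

lemma chrBasis_apply {n : ℕ} (ξ : Fin (n + 1) → ℤ) : chrBasis n ξ = chrL2 ξ := by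
  rw [chrBasis, HilbertBasis.coe_mkOfOrthogonalEqBot]

lemma chrBasis_repr {n : ℕ} {F : Slab n → ℂ} (hF : MemLp F 2 volume) (ξ : Fin (n + 1) → ℤ) :
    (chrBasis n).repr (hF.toLp F) ξ = fourierCoef F ξ := by
  rw [HilbertBasis.repr_apply_apply, chrBasis_apply, inner_chrL2]

/-- Parseval's identity for the bilinear pairing. -/
lemma hasSum_integral_mul {n : ℕ} {F W : Slab n → ℂ} (hF : MemLp F 2 volume)
    (hW : MemLp W 2 volume) :
    HasSum (fun ξ => fourierCoef F ξ * ∫ z, chr ξ z * W z) (∫ z, F z * W z) := by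
  have hW' : MemLp (fun z => conj (W z)) 2 volume := hW.star
  have h := (chrBasis n).hasSum_inner_mul_inner (hW'.toLp _) (hF.toLp F)
  have h1 : ∀ ξ, inner ℂ (hW'.toLp _) (chrBasis n ξ) * inner ℂ (chrBasis n ξ) (hF.toLp F) =
      fourierCoef F ξ * ∫ z, chr ξ z * W z := by
    intro ξ
    rw [chrBasis_apply, inner_chrL2, ← inner_conj_symm, inner_chrL2, mul_comm]
    congr 1
    rw [fourierCoef, ← integral_conj]
    simp
  have h2 : inner ℂ (hW'.toLp _) (hF.toLp F) = ∫ z, F z * W z := by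
    rw [L2.inner_def]
    refine integral_congr_ae ?_
    filter_upwards [hF.coeFn_toLp, hW'.coeFn_toLp] with z h1 h2
    rw [h1, h2, RCLike.inner_apply, RCLike.conj_conj]
  simp only [h1, h2] at h
  exact h

lemma hasSum_sq_fourierCoef {n : ℕ} {F : Slab n → ℂ} (hF : MemLp F 2 volume) :
    HasSum (fun ξ => ‖fourierCoef F ξ‖ ^ 2) (∫ z, ‖F z‖ ^ 2) := by
  have h := hasSum_integral_mul hF hF.star
  have h2 : ∀ ξ, fourierCoef F ξ * ∫ z, chr ξ z * star F z = ((‖fourierCoef F ξ‖ ^ 2 : ℝ) : ℂ) := by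
    intro ξ
    have : ∫ z, chr ξ z * star F z = conj (fourierCoef F ξ) := by
      rw [fourierCoef, ← integral_conj]
      refine integral_congr_ae (ae_of_all _ fun z => ?_)
      simp
    rw [this, Complex.mul_conj, Complex.normSq_eq_norm_sq]
  have h3 : ∫ z, F z * star F z = ((∫ z, ‖F z‖ ^ 2 : ℝ) : ℂ) := by
    rw [← integral_complex_ofReal]
    refine integral_congr_ae (ae_of_all _ fun z => ?_)
    simp only [Pi.star_apply, RCLike.star_def]
    rw [Complex.mul_conj, Complex.normSq_eq_norm_sq]
  simp only [h2, h3] at h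
  exact Complex.hasSum_ofReal.1 h

lemma ae_eq_of_fourierCoef_eq {n : ℕ} {F G : Slab n → ℂ} (hF : MemLp F 2 volume)
    (hG : MemLp G 2 volume) (h : ∀ ξ, fourierCoef F ξ = fourierCoef G ξ) : F =ᵐ[volume] G := by
  rw [← MemLp.toLp_eq_toLp_iff hF hG]
  apply (chrBasis n).repr.injective
  ext ξ
  rw [chrBasis_repr, chrBasis_repr, h]

/-- The Riesz–Fischer theorem: every square summable family is the family of Fourier coefficients
of an `L²` function, to which the Fourier series converges. -/
lemma exists_fourierCoef_eq {n : ℕ} {c : (Fin (n + 1) → ℤ) → ℂ}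
    (hc : Summable fun ξ => ‖c ξ‖ ^ 2) :
    ∃ F : Slab n → ℂ, MemLp F 2 volume ∧ (∀ ξ, fourierCoef F ξ = c ξ) ∧
      Tendsto (fun S : Finset (Fin (n + 1) → ℤ) =>
        eLpNorm (fun z => ∑ ξ ∈ S, c ξ * chr ξ z - F z) 2 volume) atTop (𝓝 0) := by
  have hmem : Memℓp c 2 := by
    refine memℓp_gen ?_
    simpa using hc
  set F := (chrBasis n).repr.symm ⟨c, hmem⟩
  refine ⟨F, Lp.memLp F, fun ξ => ?_, ?_⟩
  · rw [← chrBasis_repr (Lp.memLp F), Lp.toLp_coeFn]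
    simp [F]
  · have h := (chrBasis n).hasSum_repr_symm ⟨c, hmem⟩
    have h2 := (Lp.tendsto_Lp_iff_tendsto_eLpNorm' _ _).1 h
    refine h2.congr fun S => eLpNorm_congr_ae ?_
    have h3 : ∀ S : Finset (Fin (n + 1) → ℤ),
        (((∑ ξ ∈ S, c ξ • chrBasis n ξ : Lp ℂ 2 (volume : Measure (Slab n)))) : Slab n → ℂ)
          =ᵐ[volume] fun z => ∑ ξ ∈ S, c ξ * chr ξ z := by
      intro S
      classical
      induction S using Finset.induction_on with
      | empty =>
        simp only [Finset.sum_empty]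
        exact Lp.coeFn_zero _ _ _
      | insert ξ S hξ ih =>
        rw [Finset.sum_insert hξ]
        filter_upwards [Lp.coeFn_add (c ξ • chrBasis n ξ) (∑ ξ ∈ S, c ξ • chrBasis n ξ), ih,
          Lp.coeFn_smul (c ξ) (chrBasis n ξ), MemLp.coeFn_toLp (memLp_of_continuous
            (continuous_chr ξ) 2 (μ := (volume : Measure (Slab n))))] with z h1 h2 h3 h4
        rw [h1, Pi.add_apply, h2, h3, Finset.sum_insert hξ, Pi.smul_apply, chrBasis_apply, chrL2,
          h4, smul_eq_mul]
    filter_upwards [h3 S] with z hz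
    rw [Pi.sub_apply]
    rw [← hz]

/-! ### Smooth functions on the cylinder -/

/-- The universal covering of the cylinder. -/
def cover {n : ℕ} (z : Fin (n + 1) → ℝ) : Cylinder n := (z 0, fun j => (z j.succ : UnitAddCircle))

lemma isOpenQuotientMap_cover {n : ℕ} : IsOpenQuotientMap (cover (n := n)) := by
  have h1 : IsOpenQuotientMap (Prod.map (id : ℝ → ℝ)
      (Pi.map fun (_ : Fin n) (t : ℝ) => (t : UnitAddCircle))) :=
    IsOpenQuotientMap.prodMap .id (.piMap fun _ => QuotientAddGroup.isOpenQuotientMap_mk)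
  exact h1.comp (Fin.consEquivL ℝ (fun _ : Fin (n + 1) => ℝ)).symm.toHomeomorph.isOpenQuotientMap

lemma cover_add_smul {n : ℕ} (z : Fin (n + 1) → ℝ) (i : Fin (n + 1)) (t : ℝ) :
    cover (z + t • Pi.single i 1) = cover z + displacement i t := by
  refine Fin.cases ?_ (fun j => ?_) i
  · ext k
    · simp [cover, displacement]
    · simp [cover, displacement]
  · ext k
    · simp [cover, displacement]
    · by_cases h : k = j
      · subst h; simp [cover, displacement]
      · have h' : k.succ ≠ j.succ := fun e => h (Fin.succ_injective _ e)
        simp [cover, displacement, Pi.single_eq_of_ne h, Pi.single_eq_of_ne h']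

lemma displacement_add {n : ℕ} (i : Fin (n + 1)) (s t : ℝ) :
    (displacement i (s + t) : Cylinder n) = displacement i s + displacement i t := by
  refine Fin.cases ?_ (fun j => ?_) i
  · simp [displacement]
  · simp [displacement, Pi.single_add]

lemma displacement_zero {n : ℕ} (i : Fin (n + 1)) : (displacement i 0 : Cylinder n) = 0 := by
  have := displacement_add (n := n) i 0 0
  rw [add_zero] at this
  exact left_eq_add.1 this

lemma IsSmooth.hasDerivAt {n : ℕ} {φ : Cylinder n → ℂ} (hφ : IsSmooth φ) (i : Fin (n + 1))
    (p : Cylinder n) (s : ℝ) :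
    HasDerivAt (fun t => φ (p + displacement i t)) (partialD i φ (p + displacement i s)) s := by
  have key : ∀ p : Cylinder n, DifferentiableAt ℝ (fun t => φ (p + displacement i t)) 0 := by
    intro p
    obtain ⟨z, rfl⟩ := isOpenQuotientMap_cover.surjective p
    have h1 : (fun t => φ (cover z + displacement i t)) =
        (fun z => φ (cover z)) ∘ fun t : ℝ => z + t • (Pi.single i 1 : Fin (n + 1) → ℝ) := by
      funext t
      simp only [Function.comp_apply, cover_add_smul]
    rw [h1]
    exact ((ContDiff.differentiable hφ (by simp)) _).comp _ (by fun_prop)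
  have h2 := (key (p + displacement i s)).hasDerivAt
  have h3 : (fun t => φ (p + displacement i t)) =
      (fun t => φ (p + displacement i s + displacement i t)) ∘ fun t => t - s := by
    funext t
    simp only [Function.comp_apply, add_assoc, ← displacement_add]
    congr 3
    ring
  rw [h3]
  have h4 : HasDerivAt (fun t : ℝ => t - s) 1 s := (hasDerivAt_id s).sub_const s
  have h5 : HasDerivAt (fun t => φ (p + displacement i s + displacement i t))
      (partialD i φ (p + displacement i s)) (s - s) := by
    rw [sub_self]; exact h2
  simpa using HasDerivAt.scomp (h := fun t => t - s) s h5 h4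

lemma IsSmooth.partialD_cover {n : ℕ} {φ : Cylinder n → ℂ} (hφ : IsSmooth φ) (i : Fin (n + 1))
    (z : Fin (n + 1) → ℝ) :
    partialD i φ (cover z) = fderiv ℝ (fun z => φ (cover z)) z (Pi.single i 1) := by
  have h1 := hφ.hasDerivAt i (cover z) 0
  rw [displacement_zero, add_zero] at h1
  refine h1.unique ?_
  have h2 : (fun t => φ (cover z + displacement i t)) =
      (fun z => φ (cover z)) ∘ fun t : ℝ => z + t • (Pi.single i 1 : Fin (n + 1) → ℝ) := by
    funext t
    simp only [Function.comp_apply, cover_add_smul]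
  rw [h2]
  have h3 : HasDerivAt (fun t : ℝ => z + t • (Pi.single i 1 : Fin (n + 1) → ℝ))
      (Pi.single i 1) 0 := by
    simpa using ((hasDerivAt_id (0 : ℝ)).smul_const
      (Pi.single i 1 : Fin (n + 1) → ℝ)).const_add z
  refine HasFDerivAt.comp_hasDerivAt (0 : ℝ) ?_ h3
  rw [zero_smul, add_zero]
  exact ((ContDiff.differentiable hφ (by simp)) z).hasFDerivAt

lemma IsSmooth.continuous {n : ℕ} {φ : Cylinder n → ℂ} (hφ : IsSmooth φ) : Continuous φ :=
  (isOpenQuotientMap_cover.continuous_comp_iff).1 (ContDiff.continuous hφ)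

lemma IsSmooth.continuous_partialD {n : ℕ} {φ : Cylinder n → ℂ} (hφ : IsSmooth φ)
    (i : Fin (n + 1)) : Continuous (partialD i φ) := by
  refine (isOpenQuotientMap_cover.continuous_comp_iff).1 ?_
  have : partialD i φ ∘ cover = fun z => fderiv ℝ (fun z => φ (cover z)) z (Pi.single i 1) :=
    funext fun z => hφ.partialD_cover i z
  rw [this]
  exact (ContDiff.continuous_fderiv hφ (by simp)).clm_apply continuous_const

lemma IsSmooth.mul {n : ℕ} {φ ψ : Cylinder n → ℂ} (hφ : IsSmooth φ) (hψ : IsSmooth ψ) :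
    IsSmooth (fun p => φ p * ψ p) := ContDiff.mul hφ hψ

lemma IsSmooth.const_mul {n : ℕ} {φ : Cylinder n → ℂ} (hφ : IsSmooth φ) (c : ℂ) :
    IsSmooth (fun p => c * φ p) := ContDiff.mul contDiff_const hφ

lemma IsSmooth.sum {n : ℕ} {ι : Type*} {S : Finset ι} {φ : ι → Cylinder n → ℂ}
    (hφ : ∀ i ∈ S, IsSmooth (φ i)) : IsSmooth (fun p => ∑ i ∈ S, φ i p) := ContDiff.sum hφ

lemma partialD_mul {n : ℕ} {φ ψ : Cylinder n → ℂ} (hφ : IsSmooth φ) (hψ : IsSmooth ψ)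
    (i : Fin (n + 1)) (p : Cylinder n) :
    partialD i (fun p => φ p * ψ p) p = partialD i φ p * ψ p + φ p * partialD i ψ p := by
  have h := (hφ.hasDerivAt i p 0).mul (hψ.hasDerivAt i p 0)
  simp only [displacement_zero, add_zero] at h
  exact h.deriv

lemma partialD_const_mul {n : ℕ} {φ : Cylinder n → ℂ} (hφ : IsSmooth φ) (c : ℂ)
    (i : Fin (n + 1)) (p : Cylinder n) :
    partialD i (fun p => c * φ p) p = c * partialD i φ p := by
  have h := (hφ.hasDerivAt i p 0).const_mul c
  simp only [displacement_zero, add_zero] at h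
  exact h.deriv

lemma partialD_sum {n : ℕ} {ι : Type*} {S : Finset ι} {φ : ι → Cylinder n → ℂ}
    (hφ : ∀ k ∈ S, IsSmooth (φ k)) (i : Fin (n + 1)) (p : Cylinder n) :
    partialD i (fun p => ∑ k ∈ S, φ k p) p = ∑ k ∈ S, partialD i (φ k) p := by
  have h := HasDerivAt.fun_sum fun k hk => (hφ k hk).hasDerivAt i p 0
  simp only [displacement_zero, add_zero] at h
  exact h.deriv

lemma wave_cover {n : ℕ} (θ : ℝ) (k : Fin n → ℤ) (z : Fin (n + 1) → ℝ) :
    wave θ k (cover z) =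
      Complex.exp (2 * Real.pi * Complex.I * ((θ * z 0 + ∑ j, (k j : ℝ) * z j.succ : ℝ) : ℂ)) := by
  simp only [wave, cover, UnitAddTorus.mFourier, ContinuousMap.coe_mk, fourier_coe_apply]
  rw [← Complex.exp_sum, ← Complex.exp_add]
  congr 1
  push_cast
  rw [mul_add, Finset.mul_sum]
  congr 1
  · ring
  · exact Finset.sum_congr rfl fun j _ => by ring

lemma isSmooth_wave {n : ℕ} (θ : ℝ) (k : Fin n → ℤ) : IsSmooth (wave θ k) := by
  have : (fun z : Fin (n + 1) → ℝ => wave θ k (z 0, fun j => (z j.succ : UnitAddCircle))) =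
      fun z => Complex.exp (2 * Real.pi * Complex.I *
        ((θ * z 0 + ∑ j, (k j : ℝ) * z j.succ : ℝ) : ℂ)) := funext fun z => wave_cover θ k z
  rw [IsSmooth, this]
  refine Complex.contDiff_exp.comp ?_
  refine contDiff_const.mul (Complex.ofRealCLM.contDiff.comp (ContDiff.add ?_ ?_))
  · fun_prop
  · exact ContDiff.sum fun j _ => contDiff_const.mul (contDiff_apply ℝ ℝ j.succ)

lemma partialD_wave {n : ℕ} (θ : ℝ) (k : Fin n → ℤ) (i : Fin (n + 1)) (p : Cylinder n) :
    partialD i (wave θ k) p = 2 * Real.pi * Complex.I *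
      (((Fin.cons θ (fun j => (k j : ℝ)) : Fin (n + 1) → ℝ) i : ℝ) : ℂ) * wave θ k p := by
  obtain ⟨z, rfl⟩ := isOpenQuotientMap_cover.surjective p
  set c : Fin (n + 1) → ℝ := Fin.cons θ (fun j => (k j : ℝ))
  have h1 : ∀ t : ℝ, wave θ k (cover z + displacement i t) =
      wave θ k (cover z) * Complex.exp (t * (2 * Real.pi * Complex.I * (c i : ℂ))) := by
    intro t
    have hsum : ∀ z : Fin (n + 1) → ℝ, θ * z 0 + ∑ j, k j * z j.succ = ∑ i, c i * z i := by
      intro z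
      simp [c, Fin.sum_univ_succ]
    rw [← cover_add_smul, wave_cover, wave_cover, ← Complex.exp_add, hsum, hsum]
    congr 1
    simp only [Pi.add_apply, mul_add, Finset.sum_add_distrib, Pi.smul_apply, smul_eq_mul,
      Pi.single_apply, mul_ite, mul_one, mul_zero, Finset.sum_ite_eq', Finset.mem_univ, if_true]
    push_cast
    ring
  rw [partialD]
  simp only [h1]
  have h2 : HasDerivAt (fun t : ℝ => wave θ k (cover z) *
      Complex.exp (t * (2 * Real.pi * Complex.I * (c i : ℂ))))
      (wave θ k (cover z) * (Complex.exp (((0 : ℝ) : ℂ) * (2 * Real.pi * Complex.I * (c i : ℂ))) *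
        (1 * (2 * Real.pi * Complex.I * (c i : ℂ))))) 0 :=
    (((Complex.ofRealCLM.hasDerivAt (x := (0 : ℝ))).mul_const _).cexp).const_mul _
  rw [h2.deriv]
  simp
  ring

/-! ### Integration by parts -/

lemma exists_bound_toCylinder {n : ℕ} {W : Cylinder n → ℂ} (hW : Continuous W) :
    ∃ C : ℝ, ∀ z : Slab n, ‖W (toCylinder z)‖ ≤ C := by
  obtain ⟨C, hC⟩ := isCompact_univ.exists_bound_of_continuousOn
    (hW.comp continuous_toCylinder).continuousOn
  exact ⟨C, fun z => hC z (Set.mem_univ z)⟩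

lemma memLp_comp_toCylinder {n : ℕ} {W : Cylinder n → ℂ} (hW : Continuous W) (p : ENNReal) :
    MemLp (fun z => W (toCylinder z)) p (volume : Measure (Slab n)) :=
  memLp_of_continuous (hW.comp continuous_toCylinder) p

lemma toCylinder_add_displacement_succ {n : ℕ} (j : Fin n) (t : ℝ) (z : Slab n) :
    toCylinder z + displacement j.succ t =
      toCylinder (z.1, z.2 + Pi.single j (t : UnitAddCircle)) := by
  simp [toCylinder, displacement]

/-- The tangential derivatives of a smooth function have integral zero, by invariance under
translations. -/
lemma IsSmooth.integral_partialD_succ {n : ℕ} {u : Cylinder n → ℂ} (hu : IsSmooth u) (j : Fin n) :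
    ∫ z : Slab n, partialD j.succ u (toCylinder z) = 0 := by
  obtain ⟨C, hC⟩ := exists_bound_toCylinder (hu.continuous_partialD j.succ)
  have hder := (hasDerivAt_integral_of_dominated_loc_of_deriv_le (μ := (volume : Measure (Slab n)))
    (F := fun t z => u (toCylinder z + displacement j.succ t)) (x₀ := (0 : ℝ)) (s := Set.univ)
    (F' := fun t z => partialD j.succ u (toCylinder z + displacement j.succ t))
    (bound := fun _ => C) univ_mem ?_ ?_ ?_ ?_ (integrable_const _) ?_).2
  · have hconst : (fun t : ℝ => ∫ z : Slab n, u (toCylinder z + displacement j.succ t)) =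
        fun _ => ∫ z : Slab n, u (toCylinder z) := by
      funext t
      simp only [toCylinder_add_displacement_succ]
      have hmp : MeasurePreserving
          (Prod.map (id : unitInterval → unitInterval)
            (fun y : UnitAddTorus (Fin n) => y + Pi.single j (t : UnitAddCircle))) :=
        (MeasurePreserving.id volume).prod (measurePreserving_add_right volume _)
      have hcont : Continuous fun z : Slab n => u (toCylinder z) :=
        hu.continuous.comp continuous_toCylinder
      have h := integral_map (μ := (volume : Measure (Slab n))) hmp.aemeasurable
        (f := fun z => u (toCylinder z)) hcont.aestronglyMeasurable
      rw [hmp.map_eq] at h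
      exact h.symm
    rw [hconst] at hder
    simp only [displacement_zero, add_zero] at hder
    exact hder.unique (hasDerivAt_const _ _)
  · refine Eventually.of_forall fun t => Continuous.aestronglyMeasurable ?_
    exact hu.continuous.comp (continuous_toCylinder.add continuous_const)
  · simp only [displacement_zero, add_zero]
    exact (memLp_comp_toCylinder hu.continuous 1).integrable le_rfl
  · refine Continuous.aestronglyMeasurable ?_
    exact (hu.continuous_partialD _).comp (continuous_toCylinder.add continuous_const)
  · refine ae_of_all _ fun z t _ => ?_
    rw [toCylinder_add_displacement_succ]
    exact hC _
  · exact ae_of_all _ fun z t _ => hu.hasDerivAt _ _ _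

lemma IsSmooth.integral_partialD_zero {n : ℕ} {u : Cylinder n → ℂ} (hu : IsSmooth u) :
    ∫ z : Slab n, partialD 0 u (toCylinder z) =
      ∫ y : UnitAddTorus (Fin n), (u (1, y) - u (0, y)) := by
  have hint := (memLp_comp_toCylinder (hu.continuous_partialD 0) 1).integrable le_rfl
  refine (integral_prod_symm _ hint).trans (integral_congr_ae (ae_of_all _ fun y => ?_))
  have h1 : ∀ t : ℝ, HasDerivAt (fun t : ℝ => u (t, y)) (partialD 0 u (t, y)) t := by
    intro t
    have := hu.hasDerivAt 0 (0, y) t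
    simpa [displacement] using this
  have h2 := integral_subtype_comap (μ := (volume : Measure ℝ)) (s := unitInterval)
    measurableSet_Icc (fun t : ℝ => partialD 0 u (t, y))
  refine h2.trans ?_
  rw [integral_Icc_eq_integral_Ioc, ← intervalIntegral.integral_of_le zero_le_one]
  refine intervalIntegral.integral_eq_sub_of_hasDerivAt (fun t _ => h1 t) ?_
  exact ((hu.continuous_partialD 0).comp (by fun_prop :
    Continuous fun t : ℝ => ((t, y) : Cylinder n))).intervalIntegrable _ _

/-- Integration by parts for smooth functions on the slab, in the normal direction. -/
lemma IsSmooth.integral_partialD_zero_mul {n : ℕ} {φ ψ : Cylinder n → ℂ} (hφ : IsSmooth φ)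
    (hψ : IsSmooth ψ) :
    ∫ z : Slab n, partialD 0 φ (toCylinder z) * ψ (toCylinder z) =
      (∫ y : UnitAddTorus (Fin n), (φ (1, y) * ψ (1, y) - φ (0, y) * ψ (0, y))) -
      ∫ z : Slab n, φ (toCylinder z) * partialD 0 ψ (toCylinder z) := by
  have h := (hφ.mul hψ).integral_partialD_zero
  simp only [partialD_mul hφ hψ] at h
  rw [integral_add] at h
  · rw [← h]; ring
  · exact (memLp_comp_toCylinder ((hφ.continuous_partialD 0).mul hψ.continuous) 1).integrable le_rfl
  · exact (memLp_comp_toCylinder (hφ.continuous.mul (hψ.continuous_partialD 0)) 1).integrable le_rfl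

lemma IsSmooth.integral_partialD_succ_mul {n : ℕ} {φ ψ : Cylinder n → ℂ} (hφ : IsSmooth φ)
    (hψ : IsSmooth ψ) (j : Fin n) :
    ∫ z : Slab n, partialD j.succ φ (toCylinder z) * ψ (toCylinder z) =
      -∫ z : Slab n, φ (toCylinder z) * partialD j.succ ψ (toCylinder z) := by
  have h := (hφ.mul hψ).integral_partialD_succ j
  simp only [partialD_mul hφ hψ] at h
  rw [integral_add] at h
  · exact eq_neg_of_add_eq_zero_left h
  · exact (memLp_comp_toCylinder ((hφ.continuous_partialD _).mul hψ.continuous) 1).integrable le_rfl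
  · exact (memLp_comp_toCylinder (hφ.continuous.mul (hψ.continuous_partialD _)) 1).integrable le_rfl

/-- Convergence in `L²` implies convergence of the integrals against a bounded function. -/
lemma tendsto_integral_mul_of_eLpNorm {X : Type*} [MeasurableSpace X] {μ : Measure X}
    [IsProbabilityMeasure μ] {F : ℕ → X → ℂ} {G W : X → ℂ} (hF : ∀ k, MemLp (F k) 2 μ)
    (hG : MemLp G 2 μ) (hW : AEStronglyMeasurable W μ) {C : ℝ} (hC : ∀ x, ‖W x‖ ≤ C)
    (h : Tendsto (fun k => eLpNorm (fun x => F k x - G x) 2 μ) atTop (𝓝 0)) :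
    Tendsto (fun k => ∫ x, F k x * W x ∂μ) atTop (𝓝 (∫ x, G x * W x ∂μ)) := by
  have hWL : MemLp W ⊤ μ := memLp_top_of_bound hW C (ae_of_all _ hC)
  have hmul : ∀ {H : X → ℂ}, MemLp H 2 μ → MemLp (fun x => H x * W x) 2 μ := fun hH =>
    MemLp.mul hWL hH
  refine tendsto_integral_of_L1' _ (hmul hG).1
    (Eventually.of_forall fun k => (hmul (hF k)).integrable one_le_two) ?_
  have hle : ∀ k, eLpNorm ((fun x => F k x * W x) - fun x => G x * W x) 1 μ ≤
      ENNReal.ofReal C * eLpNorm (fun x => F k x - G x) 2 μ := by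
    intro k
    refine (eLpNorm_le_eLpNorm_of_exponent_le one_le_two
      ((hmul (hF k)).1.sub (hmul hG).1)).trans ?_
    refine eLpNorm_le_mul_eLpNorm_of_ae_le_mul (ae_of_all _ fun x => ?_) 2
    rw [Pi.sub_apply, ← sub_mul, norm_mul, mul_comm]
    exact mul_le_mul_of_nonneg_right (hC x) (norm_nonneg _)
  refine tendsto_of_tendsto_of_tendsto_of_le_of_le tendsto_const_nhds ?_ (fun _ => zero_le) hle
  have := ENNReal.Tendsto.const_mul (a := ENNReal.ofReal C) h (Or.inr ENNReal.ofReal_ne_top)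
  simpa using this

/-- Functions with zero trace can be integrated by parts against all smooth functions. -/
lemma HasTrace.exists_integral_mul {n : ℕ} {u : Slab n → ℂ} (hu : MemLp u 2 volume)
    (h : HasTrace u 0 0) : ∃ U : Fin (n + 1) → Slab n → ℂ, (∀ i, IsWeakPartial i u (U i)) ∧
      ∀ i (ψ : Cylinder n → ℂ), IsSmooth ψ →
        ∫ z, U i z * ψ (toCylinder z) = -∫ z, u z * partialD i ψ (toCylinder z) := by
  obtain ⟨U, hU, φ, hφ, h1, h2, h3, h4⟩ := h
  refine ⟨U, hU, fun i ψ hψ => ?_⟩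
  have hbd : ∀ {W : Cylinder n → ℂ}, Continuous W → ∀ {F : ℕ → Slab n → ℂ} {G : Slab n → ℂ},
      (∀ k, MemLp (F k) 2 volume) → MemLp G 2 volume →
      Tendsto (fun k => eLpNorm (fun x => F k x - G x) 2 volume) atTop (𝓝 0) →
      Tendsto (fun k => ∫ x, F k x * W (toCylinder x)) atTop (𝓝 (∫ x, G x * W (toCylinder x))) := by
    intro W hW F G hF hG hlim
    obtain ⟨C, hC⟩ := exists_bound_toCylinder hW
    exact tendsto_integral_mul_of_eLpNorm hF hG
      (hW.comp continuous_toCylinder).aestronglyMeasurable hC hlim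
  have hl1 := hbd hψ.continuous
    (fun k => memLp_comp_toCylinder ((hφ k).continuous_partialD i) 2) (hU i).1 (h2 i)
  have hl2 := hbd (hψ.continuous_partialD i)
    (fun k => memLp_comp_toCylinder (hφ k).continuous 2) hu h1
  revert hl1 hl2
  refine Fin.cases ?_ (fun j => ?_) i
  · intro hl1 hl2
    -- the boundary terms tend to zero
    have hbdry : ∀ c : ℝ, Tendsto (fun k => eLpNorm (fun y => φ k (c, y) -
          (0 : UnitAddTorus (Fin n) → ℂ) y) 2 volume) atTop (𝓝 0) →
        Tendsto (fun k => ∫ y, φ k (c, y) * ψ (c, y)) atTop (𝓝 0) := by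
      intro c hc
      have hcy : Continuous fun y : UnitAddTorus (Fin n) => ((c, y) : Cylinder n) := by fun_prop
      obtain ⟨C, hC⟩ := isCompact_univ.exists_bound_of_continuousOn
        (hψ.continuous.comp hcy).continuousOn
      have := tendsto_integral_mul_of_eLpNorm
        (fun k => memLp_of_continuous ((hφ k).continuous.comp hcy) 2) (MemLp.zero' (p := 2))
        (hψ.continuous.comp hcy).aestronglyMeasurable (fun y => hC y (Set.mem_univ y)) hc
      simpa using this
    have hlim := ((hbdry 1 h4).sub (hbdry 0 h3)).sub hl2
    simp only [sub_zero, zero_sub] at hlim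
    refine tendsto_nhds_unique hl1 (hlim.congr fun k => ?_)
    rw [(hφ k).integral_partialD_zero_mul hψ, integral_sub]
    · exact (memLp_of_continuous (by
        have := (hφ k).continuous; have := hψ.continuous; fun_prop) 1).integrable le_rfl
    · exact (memLp_of_continuous (by
        have := (hφ k).continuous; have := hψ.continuous; fun_prop) 1).integrable le_rfl
  · intro hl1 hl2
    refine tendsto_nhds_unique hl1 (hl2.neg.congr fun k => ?_)
    rw [(hφ k).integral_partialD_succ_mul hψ]

/-! ### Uniqueness of weak derivatives -/

/-- Smooth cutoff functions with compact support in `(0,1)` that converge to `1`. -/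
lemma exists_cutoff : ∃ χ : ℕ → ℝ → ℝ, (∀ k, ContDiff ℝ ∞ (χ k)) ∧
    (∀ k, tsupport (χ k) ⊆ Set.Ioo 0 1) ∧ (∀ k x, ‖χ k x‖ ≤ 1) ∧
    ∀ x ∈ Set.Ioo (0 : ℝ) 1, Tendsto (fun k => χ k x) atTop (𝓝 1) := by
  have hk : ∀ k : ℕ, 0 < 1 / ((k : ℝ) + 3) := fun k => by positivity
  have hk' : ∀ k : ℕ, 1 / ((k : ℝ) + 3) ≤ 1 / 3 := fun k =>
    one_div_le_one_div_of_le (by norm_num) (by linarith [Nat.cast_nonneg (α := ℝ) k])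
  let χ : ∀ k : ℕ, ContDiffBump (1 / 2 : ℝ) := fun k =>
    ⟨1 / 2 - 1 / ((k : ℝ) + 3), 1 / 2 - 1 / ((k : ℝ) + 3) / 2, by linarith [hk' k],
      by linarith [hk k]⟩
  refine ⟨fun k => χ k, fun k => (χ k).contDiff, fun k => ?_, fun k x => ?_, fun x hx => ?_⟩
  · rw [(χ k).tsupport_eq, Real.closedBall_eq_Icc]
    refine Set.Icc_subset_Ioo ?_ ?_ <;> simp only [χ] <;> linarith [hk k]
  · rw [Real.norm_of_nonneg (χ k).nonneg]
    exact (χ k).le_one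
  · refine tendsto_const_nhds.congr' ?_
    have hlim : Tendsto (fun k : ℕ => 1 / ((k : ℝ) + 3)) atTop (𝓝 0) := by
      refine tendsto_const_nhds.div_atTop (tendsto_atTop_add_const_right _ _ ?_)
      exact tendsto_natCast_atTop_atTop
    have hpos : 0 < min x (1 - x) := lt_min hx.1 (by linarith [hx.2])
    filter_upwards [hlim.eventually (gt_mem_nhds hpos)] with k hkx
    refine ((χ k).one_of_mem_closedBall ?_).symm
    rw [Real.closedBall_eq_Icc]
    have h1 := hkx.trans_le (min_le_left _ _)
    have h2 := hkx.trans_le (min_le_right _ _)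
    constructor <;> simp only [χ] <;> linarith

lemma ae_mem_Ioo {n : ℕ} : ∀ᵐ z : Slab n, (z.1 : ℝ) ∈ Set.Ioo (0 : ℝ) 1 := by
  have h1 : ∀ᵐ t : unitInterval, (t : ℝ) ∈ Set.Ioo (0 : ℝ) 1 := by
    filter_upwards [Measure.ae_ne volume (0 : unitInterval),
      Measure.ae_ne volume (1 : unitInterval)] with t h0 h1
    exact ⟨unitInterval.pos_iff_ne_zero.2 h0, unitInterval.lt_one_iff_ne_one.2 h1⟩
  exact Measure.quasiMeasurePreserving_fst.ae h1

lemma IsWeakPartial.ae_eq {n : ℕ} {i : Fin (n + 1)} {u u₁ u₂ : Slab n → ℂ}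
    (h₁ : IsWeakPartial i u u₁) (h₂ : IsWeakPartial i u u₂) : u₁ =ᵐ[volume] u₂ := by
  refine ae_eq_of_fourierCoef_eq h₁.1 h₂.1 fun ξ => ?_
  obtain ⟨χ, hs, ht, hb, hlim⟩ := exists_cutoff
  set w : Cylinder n → ℂ := wave (-(ξ 0 : ℝ)) (-Fin.tail ξ)
  set φ : ℕ → Cylinder n → ℂ := fun k p => ((χ k p.1 : ℝ) : ℂ) * w p
  have htest : ∀ k, IsTestFunction (φ k) := by
    intro k
    constructor
    · refine IsSmooth.mul ?_ (isSmooth_wave _ _)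
      exact Complex.ofRealCLM.contDiff.comp ((hs k).comp (contDiff_apply ℝ ℝ 0))
    · refine (tsupport_mul_subset_left).trans ?_
      have h1 : tsupport (fun p : Cylinder n => ((χ k p.1 : ℝ) : ℂ)) ⊆
          Prod.fst ⁻¹' tsupport (χ k) := by
        refine closure_minimal ?_ ((isClosed_tsupport _).preimage continuous_fst)
        intro p hp
        refine subset_tsupport _ ?_
        intro h0
        exact hp (by simp [h0])
      intro p hp
      exact ⟨ht k (h1 hp), Set.mem_univ _⟩
  have hconv : ∀ {v : Slab n → ℂ}, MemLp v 2 volume →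
      Tendsto (fun k => ∫ z, v z * φ k (toCylinder z)) atTop (𝓝 (fourierCoef v ξ)) := by
    intro v hv
    refine tendsto_integral_of_dominated_convergence (fun z => ‖v z‖) (fun k => ?_)
      (hv.integrable one_le_two).norm (fun k => ae_of_all _ fun z => ?_) ?_
    · exact hv.1.mul ((htest k).1.continuous.comp continuous_toCylinder).aestronglyMeasurable
    · rw [norm_mul, norm_mul, norm_wave, mul_one, Complex.norm_real]
      exact mul_le_of_le_one_right (norm_nonneg _) (hb k _)
    · filter_upwards [ae_mem_Ioo] with z hz
      rw [mul_comm, chr, conj_wave]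
      refine tendsto_const_nhds.mul ?_
      have := ((Complex.continuous_ofReal.tendsto 1).comp (hlim _ hz)).mul_const (w (toCylinder z))
      simpa [φ, w, toCylinder] using this
  refine tendsto_nhds_unique (hconv h₁.1) ((hconv h₂.1).congr fun k => ?_)
  have e1 := h₁.2 _ (htest k)
  have e2 := h₂.2 _ (htest k)
  rw [e1] at e2
  exact neg_injective e2.symm

/-! ### Fourier coefficients of the X-ray transform -/

lemma evalAt_field_eq {n : ℕ} {d : ℤ} {X : Type*} (F : X → Pol n d) (u : Fin (n + 1) → ℝ) :
    (fun z => evalAt (F z : MvPolynomial (Fin (n + 1)) ℂ) u) =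
      fun z => ∑ α ∈ exps n d, coeffFn F α z * ∏ i, (u i : ℂ) ^ α i :=
  funext fun z => evalAt_eq_sum (F z).2 u

lemma MemL2.memLp_evalAt {n : ℕ} {d : ℤ} {X : Type*} [MeasureSpace X] {F : X → Pol n d}
    (hF : MemL2 F) (u : Fin (n + 1) → ℝ) :
    MemLp (fun z => evalAt (F z : MvPolynomial (Fin (n + 1)) ℂ) u) 2 volume := by
  rw [evalAt_field_eq]
  exact memLp_finsetSum _ fun α _ => (hF α).mul_const _

lemma integrable_mul_toCylinder {n : ℕ} {F : Slab n → ℂ} (hF : MemLp F 2 volume)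
    {W : Cylinder n → ℂ} (hW : Continuous W) :
    Integrable (fun z => F z * W (toCylinder z)) volume :=
  MemLp.integrable_mul hF (memLp_comp_toCylinder hW 2)

lemma integral_evalAt_mul {n : ℕ} {d : ℤ} {F : TensorField n d} (hF : MemL2 F)
    {W : Cylinder n → ℂ} (hW : Continuous W) (u : Fin (n + 1) → ℝ) :
    ∫ z, evalAt (F z : MvPolynomial (Fin (n + 1)) ℂ) u * W (toCylinder z) =
      ∑ α ∈ exps n d, (∫ z, coeffFn F α z * W (toCylinder z)) * ∏ i, (u i : ℂ) ^ α i := by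
  have h : ∀ z, evalAt (F z : MvPolynomial (Fin (n + 1)) ℂ) u * W (toCylinder z) =
      ∑ α ∈ exps n d, (coeffFn F α z * W (toCylinder z)) * ∏ i, (u i : ℂ) ^ α i := by
    intro z
    rw [congrFun (evalAt_field_eq F u) z, Finset.sum_mul]
    exact Finset.sum_congr rfl fun α _ => by ring
  simp only [h]
  rw [integral_finsetSum _ fun α _ => (integrable_mul_toCylinder (hF α) hW).mul_const _]
  exact Finset.sum_congr rfl fun α _ => integral_mul_const _ _

/-- The Fourier coefficients of a tensor field. -/
def tensorCoef {n : ℕ} {d : ℤ} (F : TensorField n d) (ξ : Fin (n + 1) → ℤ) : Pol n d :=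
  ofCoeffs n d fun α => fourierCoef (coeffFn F α) ξ

lemma coeff_tensorCoef {n : ℕ} {d : ℤ} (F : TensorField n d) (ξ : Fin (n + 1) → ℤ)
    (α : Fin (n + 1) →₀ ℕ) : (tensorCoef F ξ : MvPolynomial (Fin (n + 1)) ℂ).coeff α =
      fourierCoef (coeffFn F α) ξ := by
  rw [tensorCoef, coeff_ofCoeffs]
  split_ifs with h
  · rfl
  · have : coeffFn F α = 0 := funext fun z => coeff_eq_zero_of_notMem_exps (F z).2 h
    simp [this, fourierCoef]

lemma fourierCoef_eq {n : ℕ} (F : Slab n → ℂ) (ξ : Fin (n + 1) → ℤ) :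
    fourierCoef F ξ = ∫ z, F z * wave (-(ξ 0 : ℝ)) (-Fin.tail ξ) (toCylinder z) := by
  simp only [fourierCoef, chr, conj_wave, mul_comm]

lemma fourierCoef_evalAt {n : ℕ} {d : ℤ} {F : TensorField n d} (hF : MemL2 F)
    (ξ : Fin (n + 1) → ℤ) (u : Fin (n + 1) → ℝ) :
    fourierCoef (fun z => evalAt (F z : MvPolynomial (Fin (n + 1)) ℂ) u) ξ =
      evalAt (tensorCoef F ξ : MvPolynomial (Fin (n + 1)) ℂ) u := by
  rw [fourierCoef_eq, integral_evalAt_mul hF (continuous_wave _ _), evalAt_eq_sum (Subtype.prop _)]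
  refine Finset.sum_congr rfl fun α _ => ?_
  rw [coeff_tensorCoef, fourierCoef_eq]

/-- The Fourier coefficient of frequency `k` of the X-ray transform of `f` in the direction `b`,
written as an integral over the slab. -/
def xrayCoef {n : ℕ} {d : ℤ} (f : TensorField n d) (b : Fin n → ℝ) (k : Fin n → ℤ) : ℂ :=
  ∫ z, evalAt (f z : MvPolynomial (Fin (n + 1)) ℂ) (Fin.cons 1 b) *
    wave (∑ j, (k j : ℝ) * b j) (-k) (toCylinder z)

/-- The map `(t, a) ↦ (t, a + t b)`, which straightens the geodesics of direction `b`. -/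
def shear {n : ℕ} (b : Fin n → ℝ) (z : Slab n) : Slab n :=
  (z.1, fun j => z.2 j + (((z.1 : ℝ) * b j : ℝ) : UnitAddCircle))

lemma continuous_shear {n : ℕ} (b : Fin n → ℝ) : Continuous (shear b) := by
  unfold shear
  refine continuous_fst.prodMk (continuous_pi fun j => ?_)
  refine ((continuous_apply j).comp continuous_snd).add ?_
  exact (AddCircle.continuous_mk' 1).comp (by fun_prop)

lemma measurePreserving_shear {n : ℕ} (b : Fin n → ℝ) : MeasurePreserving (shear b) := by
  refine MeasurePreserving.skew_product (MeasurePreserving.id volume)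
    (g := fun (t : unitInterval) (a : UnitAddTorus (Fin n)) =>
      fun j => a j + (((t : ℝ) * b j : ℝ) : UnitAddCircle)) ?_ (ae_of_all _ fun t => ?_)
  · exact (continuous_snd.comp (continuous_shear b)).measurable
  · exact (measurePreserving_add_right (volume : Measure (UnitAddTorus (Fin n)))
      (fun j => (((t : ℝ) * b j : ℝ) : UnitAddCircle))).map_eq

lemma wave_shear {n : ℕ} (b : Fin n → ℝ) (k : Fin n → ℤ) (z : Slab n) :
    wave (∑ j, (k j : ℝ) * b j) (-k) (toCylinder (shear b z)) = UnitAddTorus.mFourier (-k) z.2 := by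
  have h1 : UnitAddTorus.mFourier (-k) (shear b z).2 = UnitAddTorus.mFourier (-k) z.2 *
      Complex.exp (-(2 * Real.pi * Complex.I * ((∑ j, (k j : ℝ) * b j : ℝ) : ℂ) * (z.1 : ℝ))) := by
    simp only [UnitAddTorus.mFourier, ContinuousMap.coe_mk, shear]
    have : ∀ j, fourier ((-k) j) (z.2 j + (((z.1 : ℝ) * b j : ℝ) : UnitAddCircle)) =
        fourier ((-k) j) (z.2 j) *
          Complex.exp (-(2 * Real.pi * Complex.I * ((k j : ℝ) * b j : ℝ) * (z.1 : ℝ))) := by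
      intro j
      rw [fourier_apply, smul_add, AddCircle.toCircle_add, Circle.coe_mul, ← fourier_apply,
        ← fourier_apply, fourier_coe_apply]
      congr 2
      push_cast [Pi.neg_apply]
      ring
    simp only [this, Finset.prod_mul_distrib]
    rw [← Complex.exp_sum]
    congr 2
    push_cast
    rw [Finset.sum_neg_distrib, Finset.mul_sum, Finset.sum_mul]
  rw [wave]
  change Complex.exp (2 * Real.pi * Complex.I * _ * (z.1 : ℝ)) *
    UnitAddTorus.mFourier (-k) (shear b z).2 = _
  rw [h1, mul_left_comm, ← Complex.exp_add, add_neg_cancel, Complex.exp_zero, mul_one]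

/-- The field `f(·; 1, b)` in the coordinates that straighten the geodesics of direction `b`. -/
def straighten {n : ℕ} {d : ℤ} (f : TensorField n d) (b : Fin n → ℝ) (z : Slab n) : ℂ :=
  evalAt (f (shear b z) : MvPolynomial (Fin (n + 1)) ℂ) (Fin.cons 1 b)

lemma MemL2.memLp_straighten {n : ℕ} {d : ℤ} {f : TensorField n d} (hf : MemL2 f)
    (b : Fin n → ℝ) : MemLp (straighten f b) 2 volume :=
  (hf.memLp_evalAt (Fin.cons 1 b)).comp_measurePreserving (measurePreserving_shear b)

lemma integral_straighten_mul {n : ℕ} {d : ℤ} {f : TensorField n d} (hf : MemL2 f)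
    (b : Fin n → ℝ) (k : Fin n → ℤ) :
    ∫ z, straighten f b z * UnitAddTorus.mFourier (-k) z.2 = xrayCoef f b k := by
  have hm := measurePreserving_shear b
  have h := integral_map (μ := (volume : Measure (Slab n))) hm.aemeasurable
    (f := fun z => evalAt (f z : MvPolynomial (Fin (n + 1)) ℂ) (Fin.cons 1 b) *
      wave (∑ j, (k j : ℝ) * b j) (-k) (toCylinder z)) (by
      rw [hm.map_eq]
      exact (integrable_mul_toCylinder (hf.memLp_evalAt _) (continuous_wave _ _)).1)
  rw [hm.map_eq] at h
  rw [xrayCoef, h]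
  simp only [wave_shear]
  rfl

lemma integral_xray_mul {n : ℕ} {d : ℤ} {f : TensorField n d} (hf : MemL2 f) (b : Fin n → ℝ)
    {W : UnitAddTorus (Fin n) → ℂ} (hW : MemLp W 2 volume) :
    ∫ a, xray f a b * W a = ∫ z, straighten f b z * W z.2 := by
  have hW' : MemLp (fun z : Slab n => W z.2) 2 volume :=
    hW.comp_measurePreserving measurePreserving_snd
  have hint : Integrable (fun z => straighten f b z * W z.2) volume :=
    MemLp.integrable_mul (hf.memLp_straighten b) hW'
  refine Eq.trans ?_ (integral_prod_symm _ hint).symm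
  refine integral_congr_ae (ae_of_all _ fun a => ?_)
  simp only
  rw [integral_mul_const]
  rfl

/-- The X-ray transform vanishes if and only if all its Fourier coefficients do. -/
lemma xrayVanishes_iff {n : ℕ} {d : ℤ} {f : TensorField n d} (hf : MemL2 f) :
    XRayVanishes f ↔ ∀ b k, xrayCoef f b k = 0 := by
  constructor
  · intro h b k
    rw [← integral_straighten_mul hf b k, ← integral_xray_mul hf b
      (memLp_of_continuous (UnitAddTorus.mFourier (-k)).continuous 2)]
    refine integral_eq_zero_of_ae ?_
    filter_upwards [h b] with a ha
    rw [ha, zero_mul, Pi.zero_apply]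
  · intro h b
    have hint : Integrable (fun a => xray f a b) volume :=
      ((hf.memLp_straighten b).integrable one_le_two).integral_prod_right
    refine hint.ae_eq_zero_of_forall_setIntegral_eq_zero fun B hB _ => ?_
    set W : UnitAddTorus (Fin n) → ℂ := B.indicator 1
    have hW : MemLp W 2 volume := (memLp_const (1 : ℂ)).indicator hB
    have h1 : ∫ a in B, xray f a b = ∫ a, xray f a b * W a := by
      rw [← integral_indicator hB]
      refine integral_congr_ae (ae_of_all _ fun a => ?_)
      by_cases ha : a ∈ B <;> simp [W, ha]
    have hW' : MemLp (fun z : Slab n => W z.2) 2 volume :=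
      hW.comp_measurePreserving measurePreserving_snd
    rw [h1, integral_xray_mul hf b hW]
    -- by Parseval, only the frequencies with `ξ₀ = 0` contribute, and their coefficients vanish
    refine (hasSum_integral_mul (hf.memLp_straighten b) hW').unique ?_
    convert hasSum_zero with ξ
    by_cases h0 : ξ 0 = 0
    · have : fourierCoef (straighten f b) ξ = xrayCoef f b (Fin.tail ξ) := by
        rw [← integral_straighten_mul hf, fourierCoef_eq]
        simp [wave, h0, toCylinder]
      rw [this, h, zero_mul]
    · have h2 : ∫ z : Slab n, chr ξ z * W z.2 =
          (∫ t : unitInterval, Complex.exp (2 * Real.pi * Complex.I * (ξ 0 : ℝ) * (t : ℝ))) *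
            ∫ y, UnitAddTorus.mFourier (Fin.tail ξ) y * W y := by
        refine Eq.trans ?_ (integral_prod_mul (μ := (volume : Measure unitInterval))
          (ν := (volume : Measure (UnitAddTorus (Fin n)))) _ _)
        refine integral_congr_ae (ae_of_all _ fun z => ?_)
        simp only [chr, wave, toCylinder]
        ring
      have h3 := Complex.exp_int_mul_two_pi_mul_I (ξ 0)
      rw [h2, integral_exp_unitInterval (by exact_mod_cast h0),
        show 2 * (Real.pi : ℂ) * Complex.I * ((ξ 0 : ℝ) : ℂ) = ξ 0 * (2 * Real.pi * Complex.I) by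
          push_cast; ring, h3]
      simp

/-! ### Fields of the form `π^*h + dg` -/

lemma isWeakGradient_weakGrad {n : ℕ} {d : ℤ} {g : TensorField n d}
    (h : ∃ G, IsWeakGradient g G) : IsWeakGradient g (weakGrad g) := by
  rw [weakGrad, dif_pos h]
  exact h.choose_spec

lemma MemH10.integral_weakGrad_mul {n : ℕ} {d : ℤ} {g : TensorField n d} (hg : MemH10 g)
    (i : Fin (n + 1)) (α : Fin (n + 1) →₀ ℕ) {ψ : Cylinder n → ℂ} (hψ : IsSmooth ψ) :
    ∫ z, coeffFn (weakGrad g i) α z * ψ (toCylinder z) =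
      -∫ z, coeffFn g α z * partialD i ψ (toCylinder z) := by
  obtain ⟨U, hU, hint⟩ := (hg.2 α).exists_integral_mul (hg.1.1 α)
  rw [← hint i ψ hψ]
  refine integral_congr_ae ?_
  filter_upwards [((isWeakGradient_weakGrad hg.1.2) i α).ae_eq (hU i)] with z hz
  rw [hz]

lemma memL2_weakGrad {n : ℕ} {d : ℤ} {g : TensorField n d} (h : ∃ G, IsWeakGradient g G)
    (i : Fin (n + 1)) : MemL2 (weakGrad g i) :=
  fun α => ((isWeakGradient_weakGrad h) i α).1

/-- The symmetrized derivative of a field in `H¹₀` has vanishing X-ray transform: the wave by which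
one integrates is constant along the geodesics. -/
lemma MemH10.integral_symDeriv_mul {n : ℕ} {d : ℤ} {g : TensorField n d} (hg : MemH10 g)
    (b : Fin n → ℝ) (k : Fin n → ℤ) :
    ∫ z, evalAt (symDeriv g z) (Fin.cons 1 b) *
      wave (∑ j, (k j : ℝ) * b j) (-k) (toCylinder z) = 0 := by
  set θ := ∑ j, (k j : ℝ) * b j
  set u : Fin (n + 1) → ℝ := Fin.cons 1 b
  set c : Fin (n + 1) → ℝ := Fin.cons θ fun j => (((-k) j : ℤ) : ℝ)
  have h1 : ∀ z, evalAt (symDeriv g z) u * wave θ (-k) (toCylinder z) = ∑ i, (u i : ℂ) *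
      (evalAt (weakGrad g i z : MvPolynomial (Fin (n + 1)) ℂ) u * wave θ (-k) (toCylinder z)) := by
    intro z
    have : evalAt (symDeriv g z) u =
        ∑ i, (u i : ℂ) * evalAt (weakGrad g i z : MvPolynomial (Fin (n + 1)) ℂ) u := by
      simp [symDeriv, evalAt]
    rw [this, Finset.sum_mul]
    exact Finset.sum_congr rfl fun i _ => by ring
  have h2 : ∀ i, ∫ z, evalAt (weakGrad g i z : MvPolynomial (Fin (n + 1)) ℂ) u *
      wave θ (-k) (toCylinder z) = -(2 * Real.pi * Complex.I) * (c i : ℂ) *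
        ∫ z, evalAt (g z : MvPolynomial (Fin (n + 1)) ℂ) u * wave θ (-k) (toCylinder z) := by
    intro i
    rw [integral_evalAt_mul (memL2_weakGrad hg.1.2 i) (continuous_wave _ _),
      integral_evalAt_mul hg.1.1 (continuous_wave _ _), Finset.mul_sum]
    refine Finset.sum_congr rfl fun α _ => ?_
    rw [hg.integral_weakGrad_mul i α (isSmooth_wave _ _)]
    simp only [partialD_wave]
    have : ∀ z, coeffFn g α z * (2 * Real.pi * Complex.I * (c i : ℂ) * wave θ (-k) (toCylinder z)) =
        2 * Real.pi * Complex.I * (c i : ℂ) * (coeffFn g α z * wave θ (-k) (toCylinder z)) :=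
      fun z => by ring
    simp only [c] at this
    simp only [this, integral_const_mul, c]
    ring
  simp only [h1]
  rw [integral_finsetSum]
  · simp only [integral_const_mul, h2]
    have h3 : ∑ i, (u i : ℂ) * (c i : ℂ) = 0 := by
      have : ∑ i, u i * c i = 0 := by
        simp only [u, c, Fin.sum_univ_succ, Fin.cons_zero, Fin.cons_succ, Pi.neg_apply,
          Int.cast_neg, one_mul, θ]
        rw [← Finset.sum_add_distrib]
        exact Finset.sum_eq_zero fun j _ => by ring
      exact_mod_cast this
    set I := ∫ z, evalAt (g z : MvPolynomial (Fin (n + 1)) ℂ) u * wave θ (-k) (toCylinder z)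
    calc ∑ i, (u i : ℂ) * (-(2 * Real.pi * Complex.I) * (c i : ℂ) * I)
        = (∑ i, (u i : ℂ) * (c i : ℂ)) * (-(2 * Real.pi * Complex.I) * I) := by
          rw [Finset.sum_mul]; exact Finset.sum_congr rfl fun i _ => by ring
      _ = 0 := by rw [h3, zero_mul]
  · intro i _
    exact (integrable_mul_toCylinder ((memL2_weakGrad hg.1.2 i).memLp_evalAt u)
      (continuous_wave _ _)).const_mul _

lemma memLp_comp_fst {n : ℕ} {F : unitInterval → ℂ} (hF : MemLp F 2 volume) :
    MemLp (fun z : Slab n => F z.1) 2 volume :=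
  hF.comp_measurePreserving measurePreserving_fst

/-- A function of `x` alone is orthogonal to the waves with `k ≠ 0`. -/
lemma integral_fst_mul_wave {n : ℕ} (F : unitInterval → ℂ) (θ : ℝ) (k : Fin n → ℤ) :
    ∫ z : Slab n, F z.1 * wave θ k (toCylinder z) =
      (∫ t, F t * Complex.exp (2 * Real.pi * Complex.I * θ * (t : ℝ))) *
        ∫ y : UnitAddTorus (Fin n), UnitAddTorus.mFourier k y := by
  refine Eq.trans ?_ (integral_prod_mul (μ := (volume : Measure unitInterval))
    (ν := (volume : Measure (UnitAddTorus (Fin n)))) _ _)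
  refine integral_congr_ae (ae_of_all _ fun z => ?_)
  simp only [wave, toCylinder]
  ring

lemma IsDecomposition.xrayVanishes {n m : ℕ} {f : TensorField n m} {h : unitInterval → Pol n m}
    {g : TensorField n ((m : ℤ) - 1)} (hf : MemL2 f) (hd : IsDecomposition f h g) :
    XRayVanishes f := by
  rw [xrayVanishes_iff hf]
  intro b k
  set u : Fin (n + 1) → ℝ := Fin.cons 1 b
  set θ := ∑ j, (k j : ℝ) * b j
  have h1 : xrayCoef f b k = (∫ z : Slab n, evalAt (h z.1 : MvPolynomial (Fin (n + 1)) ℂ) u *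
      wave θ (-k) (toCylinder z)) + ∫ z, evalAt (symDeriv g z) u * wave θ (-k) (toCylinder z) := by
    rw [← integral_add]
    · refine integral_congr_ae ?_
      filter_upwards [hd.eq] with z hz
      rw [hz, ← add_mul]
      simp only [evalAt, map_add, u, θ]
    · exact integrable_mul_toCylinder (memLp_comp_fst (hd.memL2.memLp_evalAt u))
        (continuous_wave _ _)
    · refine integrable_mul_toCylinder ?_ (continuous_wave _ _)
      have : (fun z => evalAt (symDeriv g z) u) = fun z => ∑ i, (u i : ℂ) *
          evalAt (weakGrad g i z : MvPolynomial (Fin (n + 1)) ℂ) u := by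
        funext z; simp [symDeriv, evalAt]
      rw [this]
      exact memLp_finsetSum _ fun i _ =>
        ((memL2_weakGrad hd.memH10.1.2 i).memLp_evalAt u).const_mul _
  rw [h1, hd.memH10.integral_symDeriv_mul b k, add_zero, integral_fst_mul_wave
    (fun t => evalAt (h t : MvPolynomial (Fin (n + 1)) ℂ) u)]
  by_cases hk : k = 0
  · have hθ : θ = 0 := by simp [θ, hk]
    simp [hθ, hd.mean_zero u]
  · rw [integral_mFourier (neg_ne_zero.2 hk), mul_zero]

/-! ### Weak derivatives and traces of Fourier series -/

lemma tendsto_fourierSeries {n : ℕ} {F : Slab n → ℂ} (hF : MemLp F 2 volume) :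
    Tendsto (fun S : Finset (Fin (n + 1) → ℤ) =>
      eLpNorm (fun z => ∑ ξ ∈ S, fourierCoef F ξ * chr ξ z - F z) 2 volume) atTop (𝓝 0) := by
  obtain ⟨G, hG, hc, hlim⟩ := exists_fourierCoef_eq (hasSum_sq_fourierCoef hF).summable
  refine hlim.congr fun S => eLpNorm_congr_ae ?_
  filter_upwards [ae_eq_of_fourierCoef_eq hG hF hc] with z hz
  rw [hz]

lemma partialD_wave_int {n : ℕ} (ξ : Fin (n + 1) → ℤ) (i : Fin (n + 1)) (p : Cylinder n) :
    partialD i (wave (ξ 0) (Fin.tail ξ)) p =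
      2 * Real.pi * Complex.I * (ξ i : ℂ) * wave (ξ 0) (Fin.tail ξ) p := by
  rw [partialD_wave]
  have : ((Fin.cons (ξ 0 : ℝ) (fun j => (Fin.tail ξ j : ℝ)) : Fin (n + 1) → ℝ) i : ℝ) = ξ i := by
    refine Fin.cases ?_ (fun j => ?_) i
    · simp
    · simp [Fin.tail]
  rw [this]
  simp

lemma IsTestFunction.eq_zero {n : ℕ} {φ : Cylinder n → ℂ} (hφ : IsTestFunction φ)
    {p : Cylinder n} (hp : p.1 ∉ Set.Ioo (0 : ℝ) 1) : φ p = 0 := by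
  by_contra h
  exact hp (hφ.2 (subset_tsupport _ h)).1

lemma integral_chr_mul_partialD {n : ℕ} {φ : Cylinder n → ℂ} (hφ : IsTestFunction φ)
    (ξ : Fin (n + 1) → ℤ) (i : Fin (n + 1)) :
    ∫ z, chr ξ z * partialD i φ (toCylinder z) =
      -(2 * Real.pi * Complex.I * (ξ i : ℂ) * ∫ z, chr ξ z * φ (toCylinder z)) := by
  have hw := isSmooth_wave (ξ 0) (Fin.tail ξ)
  have hconst : ∫ z : Slab n, φ (toCylinder z) *
      partialD i (wave (ξ 0) (Fin.tail ξ)) (toCylinder z) =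
      2 * Real.pi * Complex.I * (ξ i : ℂ) * ∫ z, chr ξ z * φ (toCylinder z) := by
    rw [← integral_const_mul]
    refine integral_congr_ae (ae_of_all _ fun z => ?_)
    simp only [partialD_wave_int, chr]
    ring
  have hcomm : ∫ z, chr ξ z * partialD i φ (toCylinder z) =
      ∫ z, partialD i φ (toCylinder z) * wave (ξ 0) (Fin.tail ξ) (toCylinder z) := by
    simp only [chr, mul_comm]
  rw [hcomm, ← hconst]
  clear hcomm hconst
  refine Fin.cases ?_ (fun j => ?_) i
  · rw [hφ.1.integral_partialD_zero_mul hw]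
    simp only [hφ.eq_zero (p := (1, _)) (by simp), hφ.eq_zero (p := (0, _)) (by simp)]
    simp
  · exact hφ.1.integral_partialD_succ_mul hw j

/-- Weak derivatives can be computed on Fourier coefficients. -/
lemma isWeakPartial_of_fourierCoef {n : ℕ} {i : Fin (n + 1)} {u U : Slab n → ℂ}
    (hu : MemLp u 2 volume) (hU : MemLp U 2 volume)
    (h : ∀ ξ, fourierCoef U ξ = 2 * Real.pi * Complex.I * (ξ i : ℂ) * fourierCoef u ξ) :
    IsWeakPartial i u U := by
  refine ⟨hU, fun φ hφ => ?_⟩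
  have h1 := hasSum_integral_mul hu (memLp_comp_toCylinder (hφ.1.continuous_partialD i) 2)
  have h2 := (hasSum_integral_mul hU (memLp_comp_toCylinder hφ.1.continuous 2)).neg
  refine h1.unique (h2.congr_fun fun ξ => ?_)
  rw [integral_chr_mul_partialD hφ, h]
  ring

/-- Parseval's identity for trigonometric polynomials on the torus. -/
lemma integral_norm_sq_sum_mFourier {n : ℕ} (S : Finset (Fin n → ℤ)) (a : (Fin n → ℤ) → ℂ) :
    ∫ y, ‖∑ k ∈ S, a k * UnitAddTorus.mFourier k y‖ ^ 2 = ∑ k ∈ S, ‖a k‖ ^ 2 := by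
  classical
  have h1 : ∀ y, ((‖∑ k ∈ S, a k * UnitAddTorus.mFourier k y‖ ^ 2 : ℝ) : ℂ) =
      ∑ k ∈ S, ∑ l ∈ S, a k * conj (a l) * UnitAddTorus.mFourier (k + -l) y := by
    intro y
    rw [← Complex.normSq_eq_norm_sq, ← Complex.mul_conj, map_sum, Finset.sum_mul_sum]
    refine Finset.sum_congr rfl fun k _ => Finset.sum_congr rfl fun l _ => ?_
    rw [UnitAddTorus.mFourier_add, UnitAddTorus.mFourier_neg, map_mul]
    ring
  apply Complex.ofReal_injective
  rw [← integral_complex_ofReal]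
  simp only [h1]
  have hint : ∀ k l, Integrable (fun y : UnitAddTorus (Fin n) =>
      a k * conj (a l) * UnitAddTorus.mFourier (k + -l) y) volume := fun k l =>
    ((memLp_of_continuous (UnitAddTorus.mFourier (k + -l)).continuous 1).integrable
      le_rfl).const_mul _
  rw [integral_finsetSum _ fun k _ => integrable_finsetSum _ fun l _ => hint k l]
  push_cast
  refine Finset.sum_congr rfl fun k hk => ?_
  rw [integral_finsetSum _ fun l _ => hint k l, Finset.sum_eq_single k]
  · rw [integral_const_mul, add_neg_cancel, integral_mFourier_zero, mul_one, Complex.mul_conj,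
      Complex.normSq_eq_norm_sq]
    push_cast
    rfl
  · intro l _ hl
    rw [integral_const_mul, integral_mFourier, mul_zero]
    rw [← sub_eq_add_neg, sub_ne_zero]
    exact hl.symm
  · exact fun h => absurd hk h

/-- The frequencies of the torus with all components in `[-N, N]`. -/
def torusBox (n N : ℕ) : Finset (Fin n → ℤ) := Fintype.piFinset fun _ => Finset.Icc (-(N : ℤ)) N

/-- The frequencies of the slab with all components in `[-N, N]`. -/
def slabBox (n N : ℕ) : Finset (Fin (n + 1) → ℤ) :=
  (torusBox n N ×ˢ Finset.Icc (-(N : ℤ)) N).map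
    ((Equiv.prodComm _ _).trans (Fin.consEquiv fun _ : Fin (n + 1) => ℤ)).toEmbedding

lemma tendsto_Icc_atTop : Tendsto (fun N : ℕ => Finset.Icc (-(N : ℤ)) N) atTop atTop := by
  refine tendsto_atTop_finset_of_monotone (fun a b hab => ?_) fun l => ⟨l.natAbs, ?_⟩
  · exact Finset.Icc_subset_Icc (by omega) (by omega)
  · rw [Finset.mem_Icc]; omega

lemma mem_slabBox {n N : ℕ} {ξ : Fin (n + 1) → ℤ} :
    ξ ∈ slabBox n N ↔ ∀ i, ξ i ∈ Finset.Icc (-(N : ℤ)) N := by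
  rw [slabBox, Finset.mem_map_equiv, Finset.mem_product, torusBox, Fintype.mem_piFinset,
    Fin.forall_fin_succ, and_comm]
  rfl

lemma tendsto_slabBox_atTop (n : ℕ) : Tendsto (slabBox n) atTop atTop := by
  refine tendsto_atTop_finset_of_monotone (fun a b hab => ?_) fun ξ =>
    ⟨∑ i, (ξ i).natAbs, mem_slabBox.2 fun i => ?_⟩
  · intro ξ hξ
    rw [mem_slabBox] at hξ ⊢
    exact fun i => Finset.Icc_subset_Icc (by omega) (by omega) (hξ i)
  · have := Finset.single_le_sum (f := fun i => (ξ i).natAbs) (fun _ _ => Nat.zero_le _)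
      (Finset.mem_univ i)
    rw [Finset.mem_Icc]
    omega

lemma sum_slabBox {n N : ℕ} {E : Type*} [AddCommMonoid E] (F : (Fin (n + 1) → ℤ) → E) :
    ∑ ξ ∈ slabBox n N, F ξ =
      ∑ k ∈ torusBox n N, ∑ l ∈ Finset.Icc (-(N : ℤ)) N, F (Fin.cons l k) := by
  rw [slabBox, Finset.sum_map, Finset.sum_product]
  rfl

lemma summable_one_div_one_add_sq : Summable fun l : ℤ => 1 / (1 + (l : ℝ) ^ 2) := by
  refine Summable.of_norm_bounded_eventually
    ((Real.summable_one_div_int_pow (p := 2)).2 one_lt_two) ?_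
  have : ∀ᶠ l : ℤ in cofinite, l ≠ 0 := (Set.finite_singleton 0).compl_mem_cofinite
  filter_upwards [this] with l hl
  rw [Real.norm_of_nonneg (by positivity)]
  have : 0 < (l : ℝ) ^ 2 := by positivity
  exact one_div_le_one_div_of_le this (by linarith)

/-- The Cauchy–Schwarz inequality behind the trace theorem for `H¹`. -/
lemma sum_norm_sq_le {c : ℤ → ℂ} (hc : Summable fun l : ℤ => (1 + (l : ℝ) ^ 2) * ‖c l‖ ^ 2)
    (I : Finset ℤ) : (∑ l ∈ I, ‖c l‖) ^ 2 ≤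
      (∑' l : ℤ, 1 / (1 + (l : ℝ) ^ 2)) * ∑' l : ℤ, (1 + (l : ℝ) ^ 2) * ‖c l‖ ^ 2 := by
  have h := Finset.sum_sq_le_sum_mul_sum_of_sq_le_mul I (r := fun l => ‖c l‖)
    (f := fun l : ℤ => 1 / (1 + (l : ℝ) ^ 2)) (g := fun l : ℤ => (1 + (l : ℝ) ^ 2) * ‖c l‖ ^ 2)
    (fun l _ => by positivity) (fun l _ => by positivity)
    (fun l _ => le_of_eq (by field_simp))
  refine h.trans (mul_le_mul ?_ ?_ (Finset.sum_nonneg fun l _ => by positivity)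
    (tsum_nonneg fun l => by positivity))
  · exact summable_one_div_one_add_sq.sum_le_tsum _ fun l _ => by positivity
  · exact hc.sum_le_tsum _ fun l _ => by positivity

lemma summable_of_weighted {c : ℤ → ℂ}
    (hc : Summable fun l : ℤ => (1 + (l : ℝ) ^ 2) * ‖c l‖ ^ 2) : Summable c := by
  refine Summable.of_norm ?_
  refine summable_of_sum_le (c := Real.sqrt ((∑' l : ℤ, 1 / (1 + (l : ℝ) ^ 2)) *
    ∑' l : ℤ, (1 + (l : ℝ) ^ 2) * ‖c l‖ ^ 2)) (fun _ => norm_nonneg _) fun I => ?_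
  exact Real.le_sqrt_of_sq_le (sum_norm_sq_le hc I)

lemma wave_int_boundary {n : ℕ} (l : ℤ) (k : Fin n → ℤ) (y : UnitAddTorus (Fin n)) {x : ℝ}
    (hx : x = 0 ∨ x = 1) : wave l k (x, y) = UnitAddTorus.mFourier k y := by
  rcases hx with rfl | rfl
  · simp [wave]
  · have := Complex.exp_int_mul_two_pi_mul_I l
    rw [wave, show 2 * (Real.pi : ℂ) * Complex.I * ((l : ℝ) : ℂ) * ((1 : ℝ) : ℂ) =
      l * (2 * Real.pi * Complex.I) by push_cast; ring, this, one_mul]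

lemma summable_line {n : ℕ} {c : (Fin (n + 1) → ℤ) → ℂ}
    (hs : Summable fun ξ : Fin (n + 1) → ℤ => (1 + (ξ 0 : ℝ) ^ 2) * ‖c ξ‖ ^ 2) (k : Fin n → ℤ) :
    Summable fun l : ℤ => (1 + (l : ℝ) ^ 2) * ‖c (Fin.cons l k)‖ ^ 2 := by
  have hinj : Function.Injective fun l : ℤ => (Fin.cons l k : Fin (n + 1) → ℤ) :=
    fun a b hab => by simpa using congrFun hab 0
  simpa [Function.comp_def] using hs.comp_injective hinj

/-- If the coefficients of a Fourier series with values in `H¹` sum to zero on each line of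
frequencies in the normal direction, then the boundary values of the partial sums over boxes tend
to zero. -/
lemma tendsto_boundary {n : ℕ} {c : (Fin (n + 1) → ℤ) → ℂ}
    (hs : Summable fun ξ : Fin (n + 1) → ℤ => (1 + (ξ 0 : ℝ) ^ 2) * ‖c ξ‖ ^ 2)
    (h0 : ∀ k : Fin n → ℤ, ∑' l : ℤ, c (Fin.cons l k) = 0) {x : ℝ} (hx : x = 0 ∨ x = 1) :
    Tendsto (fun N => eLpNorm (fun y : UnitAddTorus (Fin n) =>
      ∑ ξ ∈ slabBox n N, c ξ * wave (ξ 0) (Fin.tail ξ) (x, y)) 2 volume) atTop (𝓝 0) := by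
  classical
  set a : ℕ → (Fin n → ℤ) → ℂ := fun N k => ∑ l ∈ Finset.Icc (-(N : ℤ)) N, c (Fin.cons l k)
  have h1 : ∀ N (y : UnitAddTorus (Fin n)),
      ∑ ξ ∈ slabBox n N, c ξ * wave (ξ 0) (Fin.tail ξ) (x, y) =
        ∑ k ∈ torusBox n N, a N k * UnitAddTorus.mFourier k y := by
    intro N y
    rw [sum_slabBox]
    refine Finset.sum_congr rfl fun k _ => ?_
    rw [Finset.sum_mul]
    refine Finset.sum_congr rfl fun l _ => ?_
    rw [Fin.cons_zero, Fin.tail_cons, wave_int_boundary l k y hx]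
  have h2 : ∀ N, eLpNorm (fun y : UnitAddTorus (Fin n) =>
      ∑ ξ ∈ slabBox n N, c ξ * wave (ξ 0) (Fin.tail ξ) (x, y)) 2 volume =
        ENNReal.ofReal (Real.sqrt (∑ k ∈ torusBox n N, ‖a N k‖ ^ 2)) := by
    intro N
    simp only [h1]
    rw [MemLp.eLpNorm_eq_integral_rpow_norm two_ne_zero ENNReal.ofNat_ne_top
      (memLp_of_continuous (by fun_prop) 2), ← integral_norm_sq_sum_mFourier, Real.sqrt_eq_rpow]
    simp
  simp only [h2]
  -- dominated convergence for the sum over the tangential frequencies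
  have h3 : Tendsto (fun N => ∑' k, if k ∈ torusBox n N then ‖a N k‖ ^ 2 else 0) atTop
      (𝓝 (∑' _ : Fin n → ℤ, (0 : ℝ))) := by
    refine tendsto_tsum_of_dominated_convergence
      (bound := fun k => (∑' l : ℤ, 1 / (1 + (l : ℝ) ^ 2)) *
        ∑' l : ℤ, (1 + (l : ℝ) ^ 2) * ‖c (Fin.cons l k)‖ ^ 2) ?_ (fun k => ?_)
      (Eventually.of_forall fun N k => ?_)
    · refine Summable.mul_left _ ?_
      have h4 := (((Equiv.prodComm _ _).trans
        (Fin.consEquiv fun _ : Fin (n + 1) => ℤ)).summable_iff.2 hs).prod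
      simpa [Function.comp_def, Fin.consEquiv] using h4
    · have h5 : Tendsto (fun N => a N k) atTop (𝓝 0) := by
        have h := (summable_of_weighted (summable_line hs k)).hasSum
        rw [h0 k] at h
        have h' : Tendsto (fun S : Finset ℤ => ∑ l ∈ S, c (Fin.cons l k)) atTop (𝓝 0) := h
        exact h'.comp tendsto_Icc_atTop
      have h6 : Tendsto (fun N => ‖a N k‖ ^ 2) atTop (𝓝 0) := by simpa using h5.norm.pow 2
      refine squeeze_zero (fun N => ?_) (fun N => ?_) h6
      · split_ifs <;> positivity
      · split_ifs
        · exact le_rfl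
        · positivity
    · have h7 : ‖a N k‖ ^ 2 ≤ _ := (pow_le_pow_left₀ (norm_nonneg _) (norm_sum_le _ _) 2).trans
        (sum_norm_sq_le (summable_line hs k) (Finset.Icc (-(N : ℤ)) N))
      split_ifs
      · rw [Real.norm_of_nonneg (by positivity)]
        exact h7
      · rw [norm_zero]
        exact (sq_nonneg _).trans h7
  rw [tsum_zero] at h3
  have h4 : ∀ N, (∑' k, if k ∈ torusBox n N then ‖a N k‖ ^ 2 else 0) =
      ∑ k ∈ torusBox n N, ‖a N k‖ ^ 2 := fun N => by
    rw [tsum_eq_sum (s := torusBox n N) fun k hk => if_neg hk]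
    exact Finset.sum_congr rfl fun k hk => if_pos hk
  simp only [h4] at h3
  have h5 := (ENNReal.continuous_ofReal.tendsto _).comp ((Real.continuous_sqrt.tendsto _).comp h3)
  simpa [Function.comp_def] using h5

/-- A function in `H¹` of the torus `𝕋ⁿ⁺¹`, given by its Fourier coefficients, has zero trace on
the boundary of the slab if its coefficients sum to zero on all lines of frequencies in the normal
direction. -/
lemma hasTrace_zero {n : ℕ} {u : Slab n → ℂ} (hu : MemLp u 2 volume)
    {U : Fin (n + 1) → Slab n → ℂ} (hU : ∀ i, MemLp (U i) 2 volume)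
    (h : ∀ i ξ, fourierCoef (U i) ξ = 2 * Real.pi * Complex.I * (ξ i : ℂ) * fourierCoef u ξ)
    (hs : Summable fun ξ : Fin (n + 1) → ℤ => (1 + (ξ 0 : ℝ) ^ 2) * ‖fourierCoef u ξ‖ ^ 2)
    (h0 : ∀ k : Fin n → ℤ, ∑' l : ℤ, fourierCoef u (Fin.cons l k) = 0) : HasTrace u 0 0 := by
  refine ⟨U, fun i => isWeakPartial_of_fourierCoef hu (hU i) (h i),
    fun N p => ∑ ξ ∈ slabBox n N, fourierCoef u ξ * wave (ξ 0) (Fin.tail ξ) p, fun N => ?_,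
    ?_, fun i => ?_, ?_, ?_⟩
  · exact IsSmooth.sum fun ξ _ => (isSmooth_wave _ _).const_mul _
  · exact (tendsto_fourierSeries hu).comp (tendsto_slabBox_atTop n)
  · refine ((tendsto_fourierSeries (hU i)).comp (tendsto_slabBox_atTop n)).congr fun N => ?_
    simp only [Function.comp_apply]
    congr 1
    funext z
    rw [partialD_sum fun ξ _ => (isSmooth_wave _ _).const_mul _]
    congr 1
    refine Finset.sum_congr rfl fun ξ _ => ?_
    rw [partialD_const_mul (isSmooth_wave _ _), partialD_wave_int, h, chr]
    ring
  · simpa using tendsto_boundary hs h0 (x := 0) (Or.inl rfl)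
  · simpa using tendsto_boundary hs h0 (x := 1) (Or.inr rfl)

/-! ### Tensor fields with prescribed Fourier coefficients -/

lemma coeffFn_ofCoeffs {n : ℕ} {d : ℤ} {X : Type*} (a : (Fin (n + 1) →₀ ℕ) → X → ℂ)
    (α : Fin (n + 1) →₀ ℕ) :
    coeffFn (fun z => ofCoeffs n d fun α => a α z) α = if α ∈ exps n d then a α else 0 := by
  funext z
  rw [coeffFn, coeff_ofCoeffs]
  split_ifs <;> rfl

lemma exists_tensorField {n : ℕ} {d : ℤ} {c : (Fin (n + 1) → ℤ) → Pol n d}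
    (hc : Summable fun ξ => coeffNormSq d (c ξ : MvPolynomial (Fin (n + 1)) ℂ)) :
    ∃ g : TensorField n d, MemL2 g ∧ ∀ α ξ, fourierCoef (coeffFn g α) ξ =
      (c ξ : MvPolynomial (Fin (n + 1)) ℂ).coeff α := by
  have hα : ∀ α ∈ exps n d, Summable fun ξ =>
      ‖(c ξ : MvPolynomial (Fin (n + 1)) ℂ).coeff α‖ ^ 2 := fun α hα =>
    Summable.of_nonneg_of_le (fun ξ => by positivity) (fun ξ =>
      Finset.single_le_sum (f := fun α => ‖(c ξ : MvPolynomial (Fin (n + 1)) ℂ).coeff α‖ ^ 2)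
        (fun _ _ => sq_nonneg _) hα) hc
  choose! G hG hGc _ using fun α (h : α ∈ exps n d) => exists_fourierCoef_eq (hα α h)
  refine ⟨fun z => ofCoeffs n d fun α => G α z, fun α => ?_, fun α ξ => ?_⟩
  · rw [coeffFn_ofCoeffs]
    split_ifs with h
    · exact hG α h
    · exact MemLp.zero
  · rw [coeffFn_ofCoeffs]
    split_ifs with h
    · exact hGc α h ξ
    · rw [coeff_eq_zero_of_notMem_exps (c ξ).2 h]
      simp [fourierCoef]

/-- The sum of the squares of the `L²` norms of the coefficients of a field of polynomials. -/
def coeffL2Sq {n : ℕ} {d : ℤ} {X : Type*} [MeasureSpace X] (F : X → Pol n d) : ℝ :=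
  ∑ α ∈ exps n d, ∫ z, ‖coeffFn F α z‖ ^ 2

lemma integrable_coeffNormSq {n : ℕ} {d : ℤ} {X : Type*} [MeasureSpace X] {F : X → Pol n d}
    (hF : MemL2 F) :
    Integrable (fun z => coeffNormSq d (F z : MvPolynomial (Fin (n + 1)) ℂ)) volume :=
  integrable_finsetSum _ fun α _ => (memLp_two_iff_integrable_sq_norm (hF α).1).1 (hF α)

lemma coeffL2Sq_eq {n : ℕ} {d : ℤ} {X : Type*} [MeasureSpace X] {F : X → Pol n d}
    (hF : MemL2 F) :
    coeffL2Sq F = ∫ z, coeffNormSq d (F z : MvPolynomial (Fin (n + 1)) ℂ) := by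
  simp only [coeffNormSq]
  rw [coeffL2Sq]
  exact (integral_finsetSum _ fun α _ => (memLp_two_iff_integrable_sq_norm (hF α).1).1 (hF α)).symm

lemma hasSum_coeffNormSq {n : ℕ} {d : ℤ} {F : TensorField n d} (hF : MemL2 F)
    {c : (Fin (n + 1) → ℤ) → Pol n d} (hc : ∀ α ξ, fourierCoef (coeffFn F α) ξ =
      (c ξ : MvPolynomial (Fin (n + 1)) ℂ).coeff α) :
    HasSum (fun ξ => coeffNormSq d (c ξ : MvPolynomial (Fin (n + 1)) ℂ)) (coeffL2Sq F) := by
  refine hasSum_sum fun α _ => ?_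
  simpa only [hc] using hasSum_sq_fourierCoef (hF α)

lemma l2NormSq_le {n : ℕ} {d : ℤ} {A : ℝ}
    (hA : ∀ p ∈ Pol n d, polNormSq p ≤ A * coeffNormSq d p) {X : Type*} [MeasureSpace X]
    {F : X → Pol n d} (hF : MemL2 F) : l2NormSq F ≤ A * coeffL2Sq F := by
  rw [coeffL2Sq_eq hF, ← integral_const_mul]
  exact integral_mono_of_nonneg (ae_of_all _ fun z => polNormSq_nonneg _)
    ((integrable_coeffNormSq hF).const_mul A) (ae_of_all _ fun z => hA _ (F z).2)

lemma aestronglyMeasurable_polNormSq {n : ℕ} {d : ℤ} {X : Type*} [MeasureSpace X]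
    {F : X → Pol n d} (hF : MemL2 F) :
    AEStronglyMeasurable (fun z => polNormSq (F z : MvPolynomial (Fin (n + 1)) ℂ)) volume := by
  have h1 : AEStronglyMeasurable (fun z => (WithLp.toLp 2 fun α : exps n d =>
      coeffFn F α z : EuclideanSpace ℂ (exps n d))) volume :=
    (PiLp.continuous_toLp 2 _).comp_aestronglyMeasurable
      (aemeasurable_pi_lambda (fun z (α : exps n d) => coeffFn F α z)
        fun α => (hF α).1.aemeasurable).aestronglyMeasurable
  have h2 := (continuous_polNormSq_ofCoeffs n d).comp_aestronglyMeasurable h1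
  refine h2.congr (ae_of_all _ fun z => ?_)
  simp only
  congr 1
  ext α
  rw [coeff_ofCoeffs]
  split_ifs with h
  · simp [extendCoeffs, h, coeffFn]
  · rw [coeff_eq_zero_of_notMem_exps (F z).2 h]

lemma coeffL2Sq_le {n : ℕ} {d : ℤ} {B : ℝ}
    (hB : ∀ p : Pol n d, coeffNormSq d (p : MvPolynomial (Fin (n + 1)) ℂ) ≤
      B * polNormSq (p : MvPolynomial (Fin (n + 1)) ℂ))
    {X : Type*} [MeasureSpace X] {F : X → Pol n d} (hF : MemL2 F) :
    coeffL2Sq F ≤ B * l2NormSq F := by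
  obtain ⟨A, hA0, hA⟩ := exists_polNormSq_le n d
  have hint : Integrable (fun z => polNormSq (F z : MvPolynomial (Fin (n + 1)) ℂ)) volume := by
    refine ((integrable_coeffNormSq hF).const_mul A).mono' (aestronglyMeasurable_polNormSq hF)
      (ae_of_all _ fun z => ?_)
    rw [Real.norm_of_nonneg (polNormSq_nonneg _)]
    exact hA _ (F z).2
  rw [coeffL2Sq_eq hF, l2NormSq, ← integral_const_mul]
  exact integral_mono (integrable_coeffNormSq hF) (hint.const_mul B) fun z => hB (F z)

/-! ### The potential -/

/-- The Fourier coefficient of frequency `ξ` of `f` vanishes on the hyperplane orthogonal to `ξ`: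
for these directions the wave that appears in the X-ray transform is periodic. -/
lemma XRayVanishes.evalAt_tensorCoef {n : ℕ} {d : ℤ} {f : TensorField n d} (hf : MemL2 f)
    (h : XRayVanishes f) (ξ : Fin (n + 1) → ℤ) (b : Fin n → ℝ)
    (hb : ∑ i, (ξ i : ℝ) * (Fin.cons 1 b : Fin (n + 1) → ℝ) i = 0) :
    evalAt (tensorCoef f ξ : MvPolynomial (Fin (n + 1)) ℂ) (Fin.cons 1 b) = 0 := by
  rw [← fourierCoef_evalAt hf, ← (xrayVanishes_iff hf).1 h b (Fin.tail ξ), fourierCoef_eq, xrayCoef]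
  have : -(ξ 0 : ℝ) = ∑ j, (Fin.tail ξ j : ℝ) * b j := by
    rw [Fin.sum_univ_succ] at hb
    simp only [Fin.cons_zero, Fin.cons_succ, mul_one] at hb
    simp only [Fin.tail]
    linarith
  rw [this]

lemma exists_potentialCoef {n : ℕ} {d : ℤ} {f : TensorField n d} (hf : MemL2 f)
    (h : XRayVanishes f) : ∃ Q : (Fin (n + 1) → ℤ) → Pol n (d - 1),
      (∀ ξ, Fin.tail ξ = 0 → Q ξ = 0) ∧
      ∀ ξ, Fin.tail ξ ≠ 0 → (tensorCoef f ξ : MvPolynomial (Fin (n + 1)) ℂ) =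
        MvPolynomial.C (2 * Real.pi * Complex.I) *
          (linForm (fun i => (ξ i : ℝ)) * (Q ξ : MvPolynomial (Fin (n + 1)) ℂ)) := by
  have key : ∀ ξ : Fin (n + 1) → ℤ, ∃ q : Pol n (d - 1), (Fin.tail ξ = 0 → q = 0) ∧
      (Fin.tail ξ ≠ 0 → (tensorCoef f ξ : MvPolynomial (Fin (n + 1)) ℂ) =
        MvPolynomial.C (2 * Real.pi * Complex.I) *
          (linForm (fun i => (ξ i : ℝ)) * (q : MvPolynomial (Fin (n + 1)) ℂ))) := by
    intro ξ
    by_cases ht : Fin.tail ξ = 0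
    · exact ⟨0, fun _ => rfl, fun hne => absurd ht hne⟩
    · obtain ⟨j, hj⟩ := Function.ne_iff.1 ht
      obtain ⟨q, hq⟩ := exists_eq_linForm_mul (tensorCoef f ξ).2 (ξ := fun i => (ξ i : ℝ)) (j := j)
        (by exact_mod_cast hj) (fun b hb => h.evalAt_tensorCoef hf ξ b hb)
      refine ⟨(2 * Real.pi * Complex.I : ℂ)⁻¹ • q, fun h0 => absurd h0 ht, fun _ => ?_⟩
      rw [hq, Submodule.coe_smul, MvPolynomial.smul_eq_C_mul]
      have h2 : (2 * Real.pi * Complex.I : ℂ) ≠ 0 := by simp [Real.pi_ne_zero]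
      have h3 : MvPolynomial.C (2 * Real.pi * Complex.I : ℂ) *
          MvPolynomial.C (2 * Real.pi * Complex.I : ℂ)⁻¹ =
            (1 : MvPolynomial (Fin (n + 1)) ℂ) := by
        rw [← MvPolynomial.C_mul, mul_inv_cancel₀ h2, MvPolynomial.C_1]
      linear_combination (-(linForm fun i => (ξ i : ℝ)) * (q : MvPolynomial (Fin (n + 1)) ℂ)) * h3
  choose Q hQ using key
  exact ⟨Q, fun ξ => (hQ ξ).1, fun ξ => (hQ ξ).2⟩

lemma coeffNormSq_C_mul {n : ℕ} (d : ℤ) (t : ℂ) (p : MvPolynomial (Fin (n + 1)) ℂ) :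
    coeffNormSq d (MvPolynomial.C t * p) = ‖t‖ ^ 2 * coeffNormSq d p := by
  simp only [coeffNormSq, MvPolynomial.coeff_C_mul, norm_mul, mul_pow, Finset.mul_sum]

lemma integral_chr_mul_wave {n : ℕ} (ξ : Fin (n + 1) → ℤ) (θ : ℝ) (k : Fin n → ℤ) :
    ∫ z, chr ξ z * wave θ (-k) (toCylinder z) =
      ∫ z, wave (ξ 0 + θ) (Fin.tail ξ - k) (toCylinder z : Cylinder n) := by
  simp only [chr, wave_mul, ← sub_eq_add_neg]

/-- The trace on the boundary of the potential vanishes. For `θ = k · b ∉ ℤ` the Fourier coefficient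
of frequency `k` of the X-ray transform in the direction `b` is `exp (2πiθ) - 1` times the Fourier
coefficient of frequency `k` of the boundary values of the potential, evaluated at `(1, b)`. -/
lemma tsum_potentialCoef {n : ℕ} {d : ℤ} {f : TensorField n d} (hf : MemL2 f)
    (h : XRayVanishes f) {Q : (Fin (n + 1) → ℤ) → Pol n (d - 1)}
    (hQ0 : ∀ ξ, Fin.tail ξ = 0 → Q ξ = 0)
    (hQ : ∀ ξ, Fin.tail ξ ≠ 0 → (tensorCoef f ξ : MvPolynomial (Fin (n + 1)) ℂ) =
        MvPolynomial.C (2 * Real.pi * Complex.I) *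
          (linForm (fun i => (ξ i : ℝ)) * (Q ξ : MvPolynomial (Fin (n + 1)) ℂ)))
    (k : Fin n → ℤ)
    (hs : ∀ α, Summable fun l : ℤ =>
      (Q (Fin.cons l k) : MvPolynomial (Fin (n + 1)) ℂ).coeff α) (α : Fin (n + 1) →₀ ℕ) :
    ∑' l : ℤ, (Q (Fin.cons l k) : MvPolynomial (Fin (n + 1)) ℂ).coeff α = 0 := by
  by_cases hk : k = 0
  · have : ∀ l : ℤ, Q (Fin.cons l k) = 0 := fun l => hQ0 _ (by rw [Fin.tail_cons, hk])
    simp [this]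
  set P : Pol n (d - 1) := ofCoeffs n (d - 1) fun α =>
    ∑' l : ℤ, (Q (Fin.cons l k) : MvPolynomial (Fin (n + 1)) ℂ).coeff α
  suffices hP : (P : MvPolynomial (Fin (n + 1)) ℂ) = 0 by
    have h1 := congrArg (MvPolynomial.coeff α) hP
    rw [coeff_ofCoeffs, MvPolynomial.coeff_zero] at h1
    split_ifs at h1 with hα
    · exact h1
    · simp [coeff_eq_zero_of_notMem_exps (Q _).2 hα]
  refine eq_zero_of_evalAt_cons_of_ne_int P.2 hk fun b hb => ?_
  set θ := ∑ j, (k j : ℝ) * b j with hθ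
  set u : Fin (n + 1) → ℝ := Fin.cons 1 b with hu
  have hPs : HasSum (fun l : ℤ => evalAt (Q (Fin.cons l k) : MvPolynomial (Fin (n + 1)) ℂ) u)
      (evalAt (P : MvPolynomial (Fin (n + 1)) ℂ) u) := by
    simp only [evalAt_eq_sum (Subtype.prop _)]
    refine hasSum_sum fun α hα => ?_
    rw [coeff_ofCoeffs, if_pos hα]
    exact (hs α).hasSum.mul_right _
  have he : Complex.exp (2 * Real.pi * Complex.I * θ) - 1 ≠ 0 := by
    rw [sub_ne_zero]
    intro h1
    obtain ⟨l, hl⟩ := Complex.exp_eq_one_iff.1 h1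
    refine hb l ?_
    have h2 : (2 * Real.pi * Complex.I : ℂ) ≠ 0 := by simp [Real.pi_ne_zero]
    have h3 : (θ : ℂ) = l := mul_left_cancel₀ h2 (by rw [hl]; ring)
    exact_mod_cast h3
  have hpar := hasSum_integral_mul (hf.memLp_evalAt u)
    (memLp_comp_toCylinder (continuous_wave θ (-k)) 2)
  have hzero :
      ∫ z, evalAt (f z : MvPolynomial (Fin (n + 1)) ℂ) u * wave θ (-k) (toCylinder z) = 0 :=
    (xrayVanishes_iff hf).1 h b k
  rw [hzero] at hpar
  have hinj : Function.Injective fun l : ℤ => (Fin.cons l k : Fin (n + 1) → ℤ) :=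
    fun a b hab => by simpa using congrFun hab 0
  have hterm : ∀ l : ℤ, fourierCoef (fun z => evalAt (f z : MvPolynomial (Fin (n + 1)) ℂ) u)
      (Fin.cons l k) * ∫ z, chr (Fin.cons l k) z * wave θ (-k) (toCylinder z) =
      (Complex.exp (2 * Real.pi * Complex.I * θ) - 1) *
        evalAt (Q (Fin.cons l k) : MvPolynomial (Fin (n + 1)) ℂ) u := by
    intro l
    have hne : (l : ℝ) + θ ≠ 0 := fun h0 => hb (-l) (by push_cast; linarith)
    have hne' : ((l : ℂ) + θ) ≠ 0 := by exact_mod_cast hne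
    have hlin : ∑ i, ((Fin.cons l k : Fin (n + 1) → ℤ) i : ℝ) * u i = l + θ := by
      simp [Fin.sum_univ_succ, hu, hθ]
    rw [fourierCoef_evalAt hf, hQ _ (by rwa [Fin.tail_cons]), evalAt_mul, evalAt_mul,
      evalAt_linForm, hlin, integral_chr_mul_wave, Fin.tail_cons, sub_self, Fin.cons_zero,
      integral_wave_zero hne]
    have hexp : Complex.exp (2 * Real.pi * Complex.I * ((l + θ : ℝ) : ℂ)) =
        Complex.exp (2 * Real.pi * Complex.I * θ) := by
      rw [show 2 * (Real.pi : ℂ) * Complex.I * ((l + θ : ℝ) : ℂ) =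
        l * (2 * Real.pi * Complex.I) + 2 * Real.pi * Complex.I * θ by push_cast; ring,
        Complex.exp_add, Complex.exp_int_mul_two_pi_mul_I, one_mul]
    rw [hexp]
    have hC : evalAt (MvPolynomial.C (2 * Real.pi * Complex.I) :
        MvPolynomial (Fin (n + 1)) ℂ) u = 2 * Real.pi * Complex.I := by simp [evalAt]
    rw [hC]
    push_cast
    have hpi : (Real.pi : ℂ) ≠ 0 := by exact_mod_cast Real.pi_ne_zero
    have hI := Complex.I_ne_zero
    field_simp
  have hsum := (hinj.hasSum_iff (f := fun ξ =>
    fourierCoef (fun z => evalAt (f z : MvPolynomial (Fin (n + 1)) ℂ) u) ξ *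
      ∫ z, chr ξ z * wave θ (-k) (toCylinder z)) (a := 0) (fun ξ hξ => ?_)).2 hpar
  · simp only [Function.comp_def, hterm] at hsum
    have h1 := (hPs.mul_left (Complex.exp (2 * Real.pi * Complex.I * θ) - 1)).unique hsum
    exact (mul_eq_zero.1 h1).resolve_left he
  · have hne : Fin.tail ξ ≠ k := fun h0 => hξ ⟨ξ 0, by simp only [← h0, Fin.cons_self_tail]⟩
    rw [integral_chr_mul_wave, integral_wave_of_ne _ (sub_ne_zero.2 hne), mul_zero]

/-! ### The part that depends only on the normal variable -/

lemma memLp_integral_snd {n : ℕ} {F : Slab n → ℂ} (hF : MemLp F 2 volume) :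
    MemLp (fun x : unitInterval => ∫ y, F (x, y)) 2 volume := by
  have hm : AEStronglyMeasurable F
      ((volume : Measure unitInterval).prod (volume : Measure (UnitAddTorus (Fin n)))) := hF.1
  refine ⟨hm.integral_prod_right', ?_⟩
  rw [eLpNorm_lt_top_iff_lintegral_rpow_enorm_lt_top two_ne_zero ENNReal.ofNat_ne_top]
  have h1 : ∀ᵐ x : unitInterval, ‖∫ y, F (x, y)‖ₑ ^ (2 : ENNReal).toReal ≤
      ∫⁻ y, ‖F (x, y)‖ₑ ^ (2 : ENNReal).toReal := by
    filter_upwards [hm.prodMk_left] with x hx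
    have h2 : ‖∫ y, F (x, y)‖ₑ ≤ eLpNorm (fun y => F (x, y)) 2 volume := by
      refine (enorm_integral_le_lintegral_enorm _).trans ?_
      rw [← eLpNorm_one_eq_lintegral_enorm]
      exact eLpNorm_le_eLpNorm_of_exponent_le one_le_two hx
    refine (ENNReal.rpow_le_rpow h2 (by simp)).trans ?_
    rw [eLpNorm_eq_lintegral_rpow_enorm_toReal two_ne_zero ENNReal.ofNat_ne_top, ← ENNReal.rpow_mul]
    simp
  refine (lintegral_mono_ae h1).trans_lt ?_
  have h3 := (eLpNorm_lt_top_iff_lintegral_rpow_enorm_lt_top two_ne_zero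
    ENNReal.ofNat_ne_top).1 hF.2
  have h4 := lintegral_prod (μ := (volume : Measure unitInterval))
    (ν := (volume : Measure (UnitAddTorus (Fin n))))
    (fun z => ‖F z‖ₑ ^ (2 : ENNReal).toReal) (hm.enorm.pow_const _)
  exact h4 ▸ h3

lemma fourierCoef_comp_fst {n : ℕ} {F : Slab n → ℂ} (hF : MemLp F 2 volume)
    (ξ : Fin (n + 1) → ℤ) : fourierCoef (fun z : Slab n => ∫ y, F (z.1, y)) ξ =
      if Fin.tail ξ = 0 then fourierCoef F ξ else 0 := by
  rw [fourierCoef_eq, integral_fst_mul_wave (fun x => ∫ y, F (x, y))]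
  split_ifs with h
  · rw [h, neg_zero, integral_mFourier_zero, mul_one, fourierCoef_eq, h, neg_zero]
    have hint := integrable_mul_toCylinder hF (continuous_wave (-(ξ 0 : ℝ)) 0)
    refine Eq.trans ?_ (integral_prod _ hint).symm
    refine integral_congr_ae (ae_of_all _ fun x => ?_)
    simp only
    rw [← integral_mul_const]
    simp [wave, toCylinder, UnitAddTorus.mFourier_zero]
  · rw [integral_mFourier (neg_ne_zero.2 h), mul_zero]

/-- The average of a tensor field over the tori `{x} × 𝕋ⁿ`. -/
def tangentialMean {n : ℕ} {d : ℤ} (f : TensorField n d) (x : unitInterval) : Pol n d :=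
  ofCoeffs n d fun α => ∫ y, coeffFn f α (x, y)

lemma coeffFn_tangentialMean {n : ℕ} {d : ℤ} (f : TensorField n d) (α : Fin (n + 1) →₀ ℕ) :
    coeffFn (tangentialMean f) α = fun x => ∫ y, coeffFn f α (x, y) := by
  have h := coeffFn_ofCoeffs (d := d) (fun α (x : unitInterval) => ∫ y, coeffFn f α (x, y)) α
  refine h.trans ?_
  split_ifs with hα
  · rfl
  · funext x
    have : ∀ z, coeffFn f α z = 0 := fun z => coeff_eq_zero_of_notMem_exps (f z).2 hα
    simp [this]

lemma memL2_tangentialMean {n : ℕ} {d : ℤ} {f : TensorField n d} (hf : MemL2 f) :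
    MemL2 (tangentialMean f) := fun α => by
  rw [coeffFn_tangentialMean]
  exact memLp_integral_snd (hf α)

lemma fourierCoef_tangentialMean {n : ℕ} {d : ℤ} {f : TensorField n d} (hf : MemL2 f)
    (α : Fin (n + 1) →₀ ℕ) (ξ : Fin (n + 1) → ℤ) :
    fourierCoef (fun z : Slab n => coeffFn (tangentialMean f) α z.1) ξ =
      if Fin.tail ξ = 0 then fourierCoef (coeffFn f α) ξ else 0 := by
  rw [coeffFn_tangentialMean]
  exact fourierCoef_comp_fst (hf α) ξ

lemma coeffL2Sq_tangentialMean_le {n : ℕ} {d : ℤ} {f : TensorField n d} (hf : MemL2 f) :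
    coeffL2Sq (tangentialMean f) ≤ coeffL2Sq f := by
  refine Finset.sum_le_sum fun α _ => ?_
  have h1 := hasSum_sq_fourierCoef (memLp_comp_fst (n := n) (memL2_tangentialMean hf α))
  have h2 : ∫ z : Slab n, ‖coeffFn (tangentialMean f) α z.1‖ ^ 2 =
      ∫ x, ‖coeffFn (tangentialMean f) α x‖ ^ 2 := by
    have hmp : MeasurePreserving (Prod.fst : Slab n → unitInterval) := measurePreserving_fst
    have h3 := integral_map (μ := (volume : Measure (Slab n))) hmp.aemeasurable
      (f := fun x => ‖coeffFn (tangentialMean f) α x‖ ^ 2) (by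
        rw [hmp.map_eq]
        exact (memL2_tangentialMean hf α).1.norm.pow 2)
    rw [hmp.map_eq] at h3
    exact h3.symm
  rw [← h2]
  refine hasSum_le (fun ξ => ?_) h1 (hasSum_sq_fourierCoef (hf α))
  rw [fourierCoef_tangentialMean hf]
  split_ifs
  · exact le_rfl
  · rw [norm_zero, zero_pow two_ne_zero]; positivity

lemma tangentialMean_mean_zero {n : ℕ} {d : ℤ} {f : TensorField n d} (hf : MemL2 f)
    (h : XRayVanishes f) (u : Fin (n + 1) → ℝ) :
    ∫ x, evalAt (tangentialMean f x : MvPolynomial (Fin (n + 1)) ℂ) u = 0 := by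
  have h0 : (tensorCoef f 0 : MvPolynomial (Fin (n + 1)) ℂ) = 0 :=
    eq_zero_of_evalAt_cons (tensorCoef f 0).2 fun b => h.evalAt_tensorCoef hf 0 b (by simp)
  rw [evalAt_field_eq, integral_finsetSum]
  · refine Finset.sum_eq_zero fun α _ => ?_
    rw [integral_mul_const]
    have h1 : fourierCoef (coeffFn f α) 0 = ∫ x, coeffFn (tangentialMean f) α x := by
      rw [coeffFn_tangentialMean, fourierCoef]
      have hone : ∀ z : Slab n, chr 0 z = 1 := fun z => by
        have : Fin.tail (0 : Fin (n + 1) → ℤ) = 0 := rfl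
        simp [chr, wave, this, UnitAddTorus.mFourier_zero]
      simp only [hone, map_one, one_mul]
      exact integral_prod _ ((hf α).integrable one_le_two)
    rw [← h1, ← coeff_tensorCoef, h0, MvPolynomial.coeff_zero, zero_mul]
  · intro α _
    exact ((memL2_tangentialMean hf α).integrable one_le_two).mul_const _

/-! ### The decomposition -/

lemma fourierCoef_add {n : ℕ} {F G : Slab n → ℂ} (hF : MemLp F 2 volume) (hG : MemLp G 2 volume)
    (ξ : Fin (n + 1) → ℤ) :
    fourierCoef (fun z => F z + G z) ξ = fourierCoef F ξ + fourierCoef G ξ := by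
  simp only [fourierCoef_eq, add_mul]
  exact integral_add (integrable_mul_toCylinder hF (continuous_wave _ _))
    (integrable_mul_toCylinder hG (continuous_wave _ _))

lemma fourierCoef_sum {n : ℕ} {ι : Type*} (S : Finset ι) {F : ι → Slab n → ℂ}
    (hF : ∀ i, MemLp (F i) 2 volume) (ξ : Fin (n + 1) → ℤ) :
    fourierCoef (fun z => ∑ i ∈ S, F i z) ξ = ∑ i ∈ S, fourierCoef (F i) ξ := by
  simp only [fourierCoef_eq, Finset.sum_mul]
  exact integral_finsetSum _ fun i _ => integrable_mul_toCylinder (hF i) (continuous_wave _ _)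

lemma coeff_X_mul_weakGrad {n : ℕ} {d : ℤ} (g : TensorField n d) (i : Fin (n + 1))
    (β : Fin (n + 1) →₀ ℕ) :
    (fun z => (MvPolynomial.X i * (weakGrad g i z : MvPolynomial (Fin (n + 1)) ℂ)).coeff β) =
      if i ∈ β.support then coeffFn (weakGrad g i) (β - Finsupp.single i 1) else 0 := by
  classical
  funext z
  rw [MvPolynomial.coeff_X_mul']
  split_ifs <;> rfl

/-- The estimates that the Fourier coefficients `Q` of the potential inherit from the division
bound. -/
lemma potentialCoef_bound {n : ℕ} {d : ℤ} {f : TensorField n d}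
    {Q : (Fin (n + 1) → ℤ) → Pol n (d - 1)}
    (hQ0 : ∀ ξ, Fin.tail ξ = 0 → Q ξ = 0)
    (hQ : ∀ ξ, Fin.tail ξ ≠ 0 → (tensorCoef f ξ : MvPolynomial (Fin (n + 1)) ℂ) =
        MvPolynomial.C (2 * Real.pi * Complex.I) *
          (linForm (fun i => (ξ i : ℝ)) * (Q ξ : MvPolynomial (Fin (n + 1)) ℂ)))
    {C : ℝ} (hC0 : 0 ≤ C) (hC : ∀ (ξ : Fin (n + 1) → ℝ) (q : Pol n (d - 1)),
      (∑ i, ξ i ^ 2) * coeffNormSq (d - 1) (q : MvPolynomial (Fin (n + 1)) ℂ) ≤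
        C * coeffNormSq d (linForm ξ * (q : MvPolynomial (Fin (n + 1)) ℂ)))
    (ξ : Fin (n + 1) → ℤ) :
    (1 + (ξ 0 : ℝ) ^ 2) * coeffNormSq (d - 1) (Q ξ : MvPolynomial (Fin (n + 1)) ℂ) ≤
        C * coeffNormSq d (tensorCoef f ξ : MvPolynomial (Fin (n + 1)) ℂ) ∧
      ∀ i, (2 * Real.pi * ξ i) ^ 2 *
          coeffNormSq (d - 1) (Q ξ : MvPolynomial (Fin (n + 1)) ℂ) ≤
        C * coeffNormSq d (tensorCoef f ξ : MvPolynomial (Fin (n + 1)) ℂ) := by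
  have hN := coeffNormSq_nonneg (d - 1) (Q ξ : MvPolynomial (Fin (n + 1)) ℂ)
  by_cases ht : Fin.tail ξ = 0
  · have h0 : coeffNormSq (d - 1) (Q ξ : MvPolynomial (Fin (n + 1)) ℂ) = 0 := by
      simp [hQ0 ξ ht, coeffNormSq]
    rw [h0]
    simp only [mul_zero]
    exact ⟨mul_nonneg hC0 (coeffNormSq_nonneg _ _),
      fun _ => mul_nonneg hC0 (coeffNormSq_nonneg _ _)⟩
  · obtain ⟨j, hj⟩ := Function.ne_iff.1 ht
    have h1 := hC (fun i => (ξ i : ℝ)) (Q ξ)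
    have hpi : ‖(2 * Real.pi * Complex.I : ℂ)‖ ^ 2 = (2 * Real.pi) ^ 2 := by
      simp [Real.pi_pos.le, abs_of_nonneg]
    have h2 : (2 * Real.pi) ^ 2 * ((∑ i, (ξ i : ℝ) ^ 2) *
        coeffNormSq (d - 1) (Q ξ : MvPolynomial (Fin (n + 1)) ℂ)) ≤
        C * coeffNormSq d (tensorCoef f ξ : MvPolynomial (Fin (n + 1)) ℂ) := by
      rw [hQ ξ ht, coeffNormSq_C_mul, hpi]
      calc _ ≤ (2 * Real.pi) ^ 2 * _ := mul_le_mul_of_nonneg_left h1 (by positivity)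
        _ = _ := by ring
    have hj1 : (1 : ℝ) ≤ (ξ j.succ : ℝ) ^ 2 := by
      have : ξ j.succ ≠ 0 := hj
      have h3 : (1 : ℤ) ≤ (ξ j.succ) ^ 2 := by
        have := pow_pos (abs_pos.2 this) 2
        rw [sq_abs] at this
        omega
      exact_mod_cast h3
    have h4 : 1 + (ξ 0 : ℝ) ^ 2 ≤ ∑ i, (ξ i : ℝ) ^ 2 := by
      rw [Fin.sum_univ_succ, add_comm]
      have := Finset.single_le_sum (f := fun j : Fin n => (ξ j.succ : ℝ) ^ 2)
        (fun _ _ => sq_nonneg _) (Finset.mem_univ j)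
      have h5 : (ξ j.succ : ℝ) ^ 2 ≤ ∑ j : Fin n, (ξ j.succ : ℝ) ^ 2 := this
      linarith
    have hS : (0 : ℝ) ≤ ∑ i, (ξ i : ℝ) ^ 2 := Finset.sum_nonneg fun _ _ => sq_nonneg _
    refine ⟨?_, fun i => ?_⟩
    · refine le_trans ?_ h2
      have h6 : (1 : ℝ) ≤ (2 * Real.pi) ^ 2 := by nlinarith [Real.pi_gt_three]
      calc _ ≤ (∑ i, (ξ i : ℝ) ^ 2) * _ := mul_le_mul_of_nonneg_right h4 hN
        _ ≤ _ := le_mul_of_one_le_left (mul_nonneg hS hN) h6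
    · refine le_trans ?_ h2
      have h5 : (ξ i : ℝ) ^ 2 ≤ ∑ i, (ξ i : ℝ) ^ 2 :=
        Finset.single_le_sum (f := fun i => (ξ i : ℝ) ^ 2) (fun _ _ => sq_nonneg _)
          (Finset.mem_univ i)
      rw [mul_pow, mul_assoc]
      exact mul_le_mul_of_nonneg_left (mul_le_mul_of_nonneg_right h5 hN) (by positivity)

/-- A field with vanishing X-ray transform is the sum of its tangential mean and of the symmetrized
derivative of a potential in `H¹₀`, with estimates by the constant of the division bound. -/
lemma XRayVanishes.exists_potential {n m : ℕ} {f : TensorField n m} (hf : MemL2 f)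
    (h : XRayVanishes f) {C : ℝ} (hC0 : 0 ≤ C)
    (hC : ∀ (ξ : Fin (n + 1) → ℝ) (q : Pol n ((m : ℤ) - 1)),
      (∑ i, ξ i ^ 2) * coeffNormSq ((m : ℤ) - 1) (q : MvPolynomial (Fin (n + 1)) ℂ) ≤
        C * coeffNormSq m (linForm ξ * (q : MvPolynomial (Fin (n + 1)) ℂ))) :
    ∃ g : TensorField n ((m : ℤ) - 1), IsDecomposition f (tangentialMean f) g ∧
      coeffL2Sq g ≤ C * coeffL2Sq f ∧ ∀ i, coeffL2Sq (weakGrad g i) ≤ C * coeffL2Sq f := by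
  obtain ⟨Q, hQ0, hQ⟩ := exists_potentialCoef hf h
  have hbd := potentialCoef_bound hQ0 hQ hC0 hC
  have hfs := (hasSum_coeffNormSq hf fun α ξ => (coeff_tensorCoef f ξ α).symm).mul_left C
  set N : (Fin (n + 1) → ℤ) → ℝ := fun ξ =>
    coeffNormSq ((m : ℤ) - 1) (Q ξ : MvPolynomial (Fin (n + 1)) ℂ)
  have hN0 : ∀ ξ, 0 ≤ N ξ := fun ξ => coeffNormSq_nonneg _ _
  have hNle : ∀ ξ, N ξ ≤ C * coeffNormSq m (tensorCoef f ξ : MvPolynomial (Fin (n + 1)) ℂ) :=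
    fun ξ => le_trans (le_mul_of_one_le_left (hN0 ξ) (by nlinarith [sq_nonneg (ξ 0 : ℝ)])) (hbd ξ).1
  have hcoeff : ∀ α ξ, ‖(Q ξ : MvPolynomial (Fin (n + 1)) ℂ).coeff α‖ ^ 2 ≤ N ξ := by
    intro α ξ
    by_cases hα : α ∈ exps n ((m : ℤ) - 1)
    · exact Finset.single_le_sum (f := fun α =>
        ‖(Q ξ : MvPolynomial (Fin (n + 1)) ℂ).coeff α‖ ^ 2) (fun _ _ => sq_nonneg _) hα
    · rw [coeff_eq_zero_of_notMem_exps (Q ξ).2 hα]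
      simpa using hN0 ξ
  -- the potential and its derivatives
  obtain ⟨g, hg, hgc⟩ := exists_tensorField (c := Q)
    (Summable.of_nonneg_of_le hN0 hNle hfs.summable)
  set D : Fin (n + 1) → (Fin (n + 1) → ℤ) → Pol n ((m : ℤ) - 1) := fun i ξ =>
    (2 * Real.pi * Complex.I * (ξ i : ℂ)) • Q ξ
  have hDcoeff : ∀ i ξ α, (D i ξ : MvPolynomial (Fin (n + 1)) ℂ).coeff α =
      2 * Real.pi * Complex.I * (ξ i : ℂ) * (Q ξ : MvPolynomial (Fin (n + 1)) ℂ).coeff α :=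
    fun i ξ α => by simp [D]
  have hDN : ∀ i ξ, coeffNormSq ((m : ℤ) - 1) (D i ξ : MvPolynomial (Fin (n + 1)) ℂ) ≤
      C * coeffNormSq m (tensorCoef f ξ : MvPolynomial (Fin (n + 1)) ℂ) := by
    intro i ξ
    refine le_trans (le_of_eq ?_) ((hbd ξ).2 i)
    simp only [D, Submodule.coe_smul, MvPolynomial.smul_eq_C_mul, coeffNormSq_C_mul]
    congr 1
    rw [mul_pow, norm_mul, mul_pow]
    simp [Real.pi_pos.le, abs_of_nonneg, mul_pow]
  choose G hG hGc using fun i => exists_tensorField (c := D i)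
    (Summable.of_nonneg_of_le (fun ξ => coeffNormSq_nonneg _ _) (hDN i) hfs.summable)
  have hrel : ∀ i α ξ, fourierCoef (coeffFn (G i) α) ξ =
      2 * Real.pi * Complex.I * (ξ i : ℂ) * fourierCoef (coeffFn g α) ξ := fun i α ξ => by
    rw [hGc, hDcoeff, hgc]
  have hgrad : IsWeakGradient g G := fun i α =>
    isWeakPartial_of_fourierCoef (hg α) (hG i α) (hrel i α)
  have hw := isWeakGradient_weakGrad ⟨G, hgrad⟩
  have hae : ∀ i α, coeffFn (weakGrad g i) α =ᵐ[volume] coeffFn (G i) α := fun i α =>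
    (hw i α).ae_eq (hgrad i α)
  have hweighted : ∀ α, Summable fun ξ : Fin (n + 1) → ℤ =>
      (1 + (ξ 0 : ℝ) ^ 2) * ‖(Q ξ : MvPolynomial (Fin (n + 1)) ℂ).coeff α‖ ^ 2 := fun α =>
    Summable.of_nonneg_of_le (fun ξ => by positivity) (fun ξ =>
      (mul_le_mul_of_nonneg_left (hcoeff α ξ) (by positivity)).trans (hbd ξ).1) hfs.summable
  have htrace : ∀ α, HasTrace (coeffFn g α) 0 0 := by
    intro α
    refine hasTrace_zero (hg α) (fun i => hG i α) (fun i => hrel i α) ?_ fun k => ?_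
    · simpa only [hgc] using hweighted α
    · simp only [hgc]
      exact tsum_potentialCoef hf h hQ0 hQ k
        (fun α => summable_of_weighted (summable_line (hweighted α) k)) α
  have hH10 : MemH10 g := ⟨⟨hg, G, hgrad⟩, htrace⟩
  refine ⟨g, ⟨memL2_tangentialMean hf, tangentialMean_mean_zero hf h, hH10, ?_⟩, ?_, fun i => ?_⟩
  · -- compare the Fourier coefficients of both sides
    have hX : ∀ i β, MemLp (fun z => (MvPolynomial.X i *
        (weakGrad g i z : MvPolynomial (Fin (n + 1)) ℂ)).coeff β) 2 volume := by
      intro i β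
      rw [coeff_X_mul_weakGrad]
      split_ifs
      · exact (hw i _).1
      · exact MemLp.zero
    have hXc : ∀ i β ξ, fourierCoef (fun z => (MvPolynomial.X i *
        (weakGrad g i z : MvPolynomial (Fin (n + 1)) ℂ)).coeff β) ξ =
        2 * Real.pi * Complex.I *
          ((ξ i : ℂ) * (MvPolynomial.X i * (Q ξ : MvPolynomial (Fin (n + 1)) ℂ)).coeff β) := by
      classical
      intro i β ξ
      rw [coeff_X_mul_weakGrad, MvPolynomial.coeff_X_mul']
      split_ifs
      · have h1 : fourierCoef (coeffFn (weakGrad g i) (β - Finsupp.single i 1)) ξ =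
            fourierCoef (coeffFn (G i) (β - Finsupp.single i 1)) ξ := by
          refine integral_congr_ae ?_
          filter_upwards [hae i (β - Finsupp.single i 1)] with z hz
          rw [hz]
        rw [h1, hrel, hgc]
        ring
      · simp [fourierCoef]
    have hβ : ∀ β, coeffFn f β =ᵐ[volume] fun z => coeffFn (tangentialMean f) β z.1 +
        ∑ i, (MvPolynomial.X i * (weakGrad g i z : MvPolynomial (Fin (n + 1)) ℂ)).coeff β := by
      intro β
      have hh := memLp_comp_fst (n := n) (memL2_tangentialMean hf β)
      have hsum := memLp_finsetSum (Finset.univ : Finset (Fin (n + 1))) fun i _ => hX i β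
      refine ae_eq_of_fourierCoef_eq (hf β) (hh.add hsum) fun ξ => ?_
      rw [fourierCoef_add hh hsum, fourierCoef_sum _ fun i => hX i β,
        fourierCoef_tangentialMean hf]
      simp only [hXc, ← Finset.mul_sum]
      have hlin := coeff_linForm_mul (fun i => (ξ i : ℝ)) (Q ξ : MvPolynomial (Fin (n + 1)) ℂ) β
      simp only [Complex.ofReal_intCast] at hlin
      rw [← hlin]
      split_ifs with ht
      · simp [hQ0 ξ ht]
      · rw [zero_add, ← coeff_tensorCoef, hQ ξ ht, MvPolynomial.coeff_C_mul]
    filter_upwards [ae_all_iff.2 hβ] with z hz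
    ext β
    rw [MvPolynomial.coeff_add, symDeriv, MvPolynomial.coeff_sum]
    exact hz β
  · exact hasSum_le hNle (hasSum_coeffNormSq hg hgc) hfs
  · have h1 : coeffL2Sq (weakGrad g i) = coeffL2Sq (G i) := by
      refine Finset.sum_congr rfl fun α _ => integral_congr_ae ?_
      filter_upwards [hae i α] with z hz
      rw [hz]
    rw [h1]
    exact hasSum_le (hDN i) (hasSum_coeffNormSq (hG i) (hGc i)) hfs

lemma exists_decomposition (n m : ℕ) : ∃ K : ℝ, ∀ f : TensorField n m, MemL2 f → XRayVanishes f →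
    ∃ (h : unitInterval → Pol n m) (g : TensorField n ((m : ℤ) - 1)),
      IsDecomposition f h g ∧ l2Norm h + h1Norm g ≤ K * l2Norm f := by
  obtain ⟨C, hC0, hC⟩ := exists_division_bound n m
  obtain ⟨A, hA0, hA⟩ := exists_polNormSq_le n m
  obtain ⟨A', hA'0, hA'⟩ := exists_polNormSq_le n ((m : ℤ) - 1)
  obtain ⟨B, hB0, hB⟩ := exists_coeffNormSq_le n m
  refine ⟨Real.sqrt (A * B) + Real.sqrt ((1 + (n + 1)) * (A' * (C * B))), fun f hf h => ?_⟩
  obtain ⟨g, hd, hg, hG⟩ := h.exists_potential hf hC0 hC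
  refine ⟨tangentialMean f, g, hd, ?_⟩
  have hfB := coeffL2Sq_le hB hf
  have h1 : l2NormSq (tangentialMean f) ≤ A * B * l2NormSq f :=
    calc l2NormSq (tangentialMean f) ≤ A * coeffL2Sq (tangentialMean f) :=
          l2NormSq_le hA hd.memL2
      _ ≤ A * (B * l2NormSq f) :=
          mul_le_mul_of_nonneg_left ((coeffL2Sq_tangentialMean_le hf).trans hfB) hA0
      _ = _ := by ring
  have hC' : ∀ {F : TensorField n ((m : ℤ) - 1)}, MemL2 F → coeffL2Sq F ≤ C * coeffL2Sq f →
      l2NormSq F ≤ A' * (C * B) * l2NormSq f := by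
    intro F hF hle
    calc l2NormSq F ≤ A' * coeffL2Sq F := l2NormSq_le hA' hF
      _ ≤ A' * (C * (B * l2NormSq f)) := mul_le_mul_of_nonneg_left
          (hle.trans (mul_le_mul_of_nonneg_left hfB hC0)) hA'0
      _ = _ := by ring
  have h2 : l2NormSq g + ∑ i, l2NormSq (weakGrad g i) ≤
      (1 + (n + 1)) * (A' * (C * B)) * l2NormSq f := by
    have h3 := Finset.sum_le_sum fun i (_ : i ∈ (Finset.univ : Finset (Fin (n + 1)))) =>
      hC' (memL2_weakGrad hd.memH10.1.2 i) (hG i)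
    rw [Finset.sum_const, Finset.card_univ, Fintype.card_fin, nsmul_eq_mul] at h3
    have h4 := hC' hd.memH10.1.1 hg
    push_cast at h3
    linarith
  rw [l2Norm, h1Norm, l2Norm, add_mul, ← Real.sqrt_mul (by positivity),
    ← Real.sqrt_mul (by positivity)]
  exact add_le_add (Real.sqrt_le_sqrt h1) (Real.sqrt_le_sqrt h2)

end PeriodicSlab

end

open PeriodicSlab in
theorem theorem2p1 (n m : ℕ) :
    ∃ C : ℝ, ∀ f : TensorField n m, MemL2 f →
      (XRayVanishes f ↔
        ∃ (h : unitInterval → Pol n m) (g : TensorField n ((m : ℤ) - 1)),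
          IsDecomposition f h g) ∧
      (XRayVanishes f ↔
        ∃ (h : unitInterval → Pol n m) (g : TensorField n ((m : ℤ) - 1)),
          IsDecomposition f h g ∧ l2Norm h + h1Norm g ≤ C * l2Norm f) := by
  obtain ⟨K, hK⟩ := exists_decomposition n m
  refine ⟨K, fun f hf => ⟨⟨fun hx => ?_, ?_⟩, ⟨hK f hf, ?_⟩⟩⟩
  · obtain ⟨h, g, hd, _⟩ := hK f hf hx
    exact ⟨h, g, hd⟩
  · rintro ⟨h, g, hd⟩
    exact hd.xrayVanishes hf
  · rintro ⟨h, g, hd, _⟩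
    exact hd.xrayVanishes hf
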